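/- Let $n\ge 2$ and let $\mathbb S^n\subset\mathbb R^{n+1}$ be the unit sphere with its standard (round) Riemannian metric $g$. Call a function $f:\mathbb S^n\to\mathbb C$ a $(\lambda,\mu)$-eigenfunction (complex-valued eigenfunction) if it is twice continuously differentiable and there exist $\lambda,\mu\in\mathbb C$ such that $$\Delta_g f=\lambda f,\qquad g(\operatorname{grad} f,\operatorname{grad} f)=\mu f^2 ,$$ where $\Delta_g=\operatorname{div}\operatorname{grad}$ is the Laplace–Beltrami operator and $g$ is extended complex-bilinearly to complexified tangent vectors. Then a function $f:\mathbb S^n\to\mathbb C$ is a $(\lambda,\mu)$-eigenfunction if and only if there exists a homogeneous polynomial $P:\mathbb R^{n+1}\to\mathbb C$ with complex coefficients such that $f=P|_{\mathbb S^n}$ and $$\Delta P=0,\qquad \Delta (P^2)=0$$ on $\mathbb R^{n+1}$, where $\Delta=\sum_{i=1}^{n+1}\partial^2/\partial (x^i)^2$. -/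

import Mathlib

open Bundle Metric InnerProductSpace
open scoped Manifold ContDiff Laplacian

noncomputable section

section RiemannianManifold

variable {n : ℕ} {M : Type*} [TopologicalSpace M] [ChartedSpace (EuclideanSpace ℝ (Fin n)) M]

/-- The `i`-th coordinate vector field `∂ᵢ` of the preferred chart around `x`, at the point with
coordinates `y`: the image of the `i`-th standard basis vector under the differential of the
inverse chart. -/
def coordVector (x : M) (y : EuclideanSpace ℝ (Fin n)) (i : Fin n) :
    TangentSpace (𝓡 n) ((chartAt (EuclideanSpace ℝ (Fin n)) x).symm y) :=
  mfderiv (𝓡 n) (𝓡 n) (chartAt (EuclideanSpace ℝ (Fin n)) x).symm y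
    (EuclideanSpace.single i (1 : ℝ) : EuclideanSpace ℝ (Fin n))

/-- The partial derivative `∂ᵢ u` of a complex-valued function of `n` real variables. -/
def partialDeriv (i : Fin n) (u : EuclideanSpace ℝ (Fin n) → ℂ)
    (y : EuclideanSpace ℝ (Fin n)) : ℂ :=
  fderiv ℝ u y (EuclideanSpace.single i (1 : ℝ))

variable [IsManifold (𝓡 n) ∞ M]
  (g : ContMDiffRiemannianMetric (𝓡 n) ∞ (EuclideanSpace ℝ (Fin n))
    (fun x : M ↦ TangentSpace (𝓡 n) x))

/-- The matrix `(gᵢⱼ)` of the Riemannian metric in the preferred chart around `x`, at the point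
with coordinates `y`. -/
def metricMatrix (x : M) (y : EuclideanSpace ℝ (Fin n)) : Matrix (Fin n) (Fin n) ℝ :=
  Matrix.of fun i j ↦
    g.inner ((chartAt (EuclideanSpace ℝ (Fin n)) x).symm y) (coordVector x y i) (coordVector x y j)

/-- The volume density `√det (gᵢⱼ)` in the preferred chart around `x`. -/
def volumeDensity (x : M) (y : EuclideanSpace ℝ (Fin n)) : ℝ :=
  Real.sqrt (metricMatrix g x y).det

/-- The `i`-th component `∑ⱼ gⁱʲ ∂ⱼ f` of the (complexified) gradient of `f` in the preferred chart
around `x`, at the point with coordinates `y`. -/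
def gradComponent (f : M → ℂ) (x : M) (i : Fin n) (y : EuclideanSpace ℝ (Fin n)) : ℂ :=
  ∑ j, ((metricMatrix g x y)⁻¹ i j : ℂ) *
    partialDeriv j (f ∘ (chartAt (EuclideanSpace ℝ (Fin n)) x).symm) y

/-- The Laplace–Beltrami operator
`Δ_g f = div grad f = (√det g)⁻¹ ∑ᵢ ∂ᵢ (√det g · ∑ⱼ gⁱʲ ∂ⱼ f)`, computed at `x` in the preferred
chart around `x` (the value does not depend on the chart). -/
def laplaceBeltrami (f : M → ℂ) (x : M) : ℂ :=
  (volumeDensity g x (chartAt (EuclideanSpace ℝ (Fin n)) x x) : ℂ)⁻¹ *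
    ∑ i, partialDeriv i (fun y ↦ (volumeDensity g x y : ℂ) * gradComponent g f x i y)
      (chartAt (EuclideanSpace ℝ (Fin n)) x x)

/-- `g (grad f, grad h)` at `x`, where `g` is extended complex-bilinearly to complexified tangent
vectors (no complex conjugation), computed in the preferred chart around `x`. -/
def gradInner (f h : M → ℂ) (x : M) : ℂ :=
  ∑ i, ∑ j, (metricMatrix g x (chartAt (EuclideanSpace ℝ (Fin n)) x x) i j : ℂ) *
    gradComponent g f x i (chartAt (EuclideanSpace ℝ (Fin n)) x x) *
    gradComponent g h x j (chartAt (EuclideanSpace ℝ (Fin n)) x x)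

/-- A function `f : (M, g) → ℂ` is a complex-valued eigenfunction, or `(λ, μ)`-eigenfunction, if it
is twice continuously differentiable and there are `λ, μ ∈ ℂ` with `Δ_g f = λ f` and
`g (grad f, grad f) = μ f²`. -/
def IsComplexEigenfunction (f : M → ℂ) : Prop :=
  ContMDiff (𝓡 n) 𝓘(ℝ, ℂ) 2 f ∧
    ∃ l m : ℂ, (∀ x, laplaceBeltrami g f x = l * f x) ∧ (∀ x, gradInner g f f x = m * f x ^ 2)

end RiemannianManifold

/-- The standard unit sphere `𝕊ⁿ ⊂ ℝⁿ⁺¹`. -/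
abbrev unitSphere (n : ℕ) : Type := sphere (0 : EuclideanSpace ℝ (Fin (n + 1))) 1

/-- The differential at `p` of the inclusion `𝕊ⁿ → ℝⁿ⁺¹`. -/
def inclusionDeriv (n : ℕ) (p : unitSphere n) :
    TangentSpace (𝓡 n) p →L[ℝ] EuclideanSpace ℝ (Fin (n + 1)) :=
  mvfderiv (𝓡 n) (Subtype.val : unitSphere n → EuclideanSpace ℝ (Fin (n + 1))) p

theorem inclusionDeriv_injective (n : ℕ) (p : unitSphere n) :
    Function.Injective (inclusionDeriv n p) := by
  have := Fact.mk (@finrank_euclideanSpace_fin ℝ _ (n + 1))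
  exact injective_mvfderiv_subtypeVal_sphere p

/-- The differential of the inclusion `𝕊ⁿ → ℝⁿ⁺¹`, read in the trivializations of the tangent
bundle, depends smoothly on the point. -/
theorem contMDiffAt_inclusionDeriv (n : ℕ) (p : unitSphere n) :
    ContMDiffAt (𝓡 n) 𝓘(ℝ, EuclideanSpace ℝ (Fin n) →L[ℝ] EuclideanSpace ℝ (Fin (n + 1))) ∞
      (fun q : unitSphere n ↦ (inclusionDeriv n q).comp
        ((trivializationAt (EuclideanSpace ℝ (Fin n))
          (fun p : unitSphere n ↦ TangentSpace (𝓡 n) p) p).symmL ℝ q)) p := by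
  have := Fact.mk (@finrank_euclideanSpace_fin ℝ _ (n + 1))
  have h := ContMDiffAt.mfderiv_const (m := ∞) (contMDiff_coe_sphere
    (E := EuclideanSpace ℝ (Fin (n + 1))) (n := n) (m := ω) p) (by simp)
  have e : (fun q : unitSphere n ↦ (inclusionDeriv n q).comp
        ((trivializationAt (EuclideanSpace ℝ (Fin n))
          (fun p : unitSphere n ↦ TangentSpace (𝓡 n) p) p).symmL ℝ q)) =
      inTangentCoordinates (𝓡 n) 𝓘(ℝ, EuclideanSpace ℝ (Fin (n + 1))) id
      (Subtype.val : unitSphere n → EuclideanSpace ℝ (Fin (n + 1)))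
      (fun q ↦ mfderiv (𝓡 n) 𝓘(ℝ, EuclideanSpace ℝ (Fin (n + 1)))
        (Subtype.val : unitSphere n → EuclideanSpace ℝ (Fin (n + 1))) q) p := by
    ext q v : 2
    simp [inTangentCoordinates, ContinuousLinearMap.inCoordinates, inclusionDeriv, mvfderiv]
    rfl
  rw [e]
  exact h

/-- The inner product of `ℝᵐ` as a continuous bilinear form. -/
def euclideanForm (m : ℕ) :
    EuclideanSpace ℝ (Fin m) →L[ℝ] EuclideanSpace ℝ (Fin m) →L[ℝ] ℝ :=
  innerSL ℝ

/-- The restriction of the Euclidean inner product of `ℝⁿ⁺¹` to the tangent space of the sphere at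
`p`, `(v, w) ↦ ⟪dι_p v, dι_p w⟫` for the inclusion `ι : 𝕊ⁿ → ℝⁿ⁺¹`. -/
def roundInner (n : ℕ) (p : unitSphere n) :
    TangentSpace (𝓡 n) p →L[ℝ] TangentSpace (𝓡 n) p →L[ℝ] ℝ :=
  (euclideanForm (n + 1)).bilinearComp (E' := EuclideanSpace ℝ (Fin n))
    (F' := EuclideanSpace ℝ (Fin n)) (inclusionDeriv n p) (inclusionDeriv n p)

theorem roundInner_apply (n : ℕ) (p : unitSphere n) (v w : TangentSpace (𝓡 n) p) :
    roundInner n p v w = inner ℝ (inclusionDeriv n p v) (inclusionDeriv n p w) := rfl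

/-- The round metric of `𝕊ⁿ`, induced by the Euclidean inner product of `ℝⁿ⁺¹`. -/
def roundMetric (n : ℕ) : ContMDiffRiemannianMetric (𝓡 n) ∞ (EuclideanSpace ℝ (Fin n))
    (fun p : unitSphere n ↦ TangentSpace (𝓡 n) p) where
  inner p := roundInner n p
  symm p v w := real_inner_comm (inclusionDeriv n p w) (inclusionDeriv n p v)
  pos p v hv := by
    rw [roundInner_apply]
    refine real_inner_self_pos.2 fun h ↦ hv ?_
    exact inclusionDeriv_injective n p (h.trans (map_zero _).symm)
  isVonNBounded p := by
    obtain ⟨K, -, hK⟩ := LinearMap.exists_antilipschitzWith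
      (E := EuclideanSpace ℝ (Fin n)) (inclusionDeriv n p).toLinearMap
      (LinearMap.ker_eq_bot.2 (inclusionDeriv_injective n p))
    refine (NormedSpace.isVonNBounded_closedBall ℝ (EuclideanSpace ℝ (Fin n)) K).subset ?_
    intro v hv
    have h1 : ‖inclusionDeriv n p v‖ ^ 2 < 1 := by
      rw [← real_inner_self_eq_norm_sq]; exact hv
    have h2 : ‖inclusionDeriv n p v‖ ≤ 1 := by nlinarith [norm_nonneg (inclusionDeriv n p v)]
    have h3 := hK.le_mul_norm (map_zero _) v
    refine mem_closedBall_zero_iff.2 (h3.trans ?_)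
    exact mul_le_of_le_one_right K.2 h2
  contMDiff := by
    intro p
    rw [contMDiffAt_section]
    have h := contMDiffAt_inclusionDeriv n p
    have h2 := (h.clm_precomp (F₃ := ℝ)).clm_comp
      ((contMDiffAt_const (c := euclideanForm (n + 1))).clm_comp h)
    refine h2.congr_of_eventuallyEq ?_
    have hb := (trivializationAt (EuclideanSpace ℝ (Fin n))
      (fun p : unitSphere n ↦ TangentSpace (𝓡 n) p) p).open_baseSet.mem_nhds
      (FiberBundle.mem_baseSet_trivializationAt' p)
    filter_upwards [hb] with q hq
    ext v w
    rw [hom_trivializationAt_apply]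
    dsimp only
    rw [inCoordinates_apply_eq₂ hq hq (Set.mem_univ _)]
    have e := Trivialization.coe_linearMapAt_of_mem (R := ℝ)
      (trivializationAt ℝ (Bundle.Trivial (unitSphere n) ℝ) p) (b := q) (Set.mem_univ q)
    refine (congrFun e _).trans ?_
    rw [← Trivialization.symmL_apply (R := ℝ) _ hq v, ← Trivialization.symmL_apply (R := ℝ) _ hq w]
    rfl

/-- The function `ℝᵐ → ℂ` defined by a polynomial with complex coefficients. -/
def polyFun {m : ℕ} (P : MvPolynomial (Fin m) ℂ) (x : EuclideanSpace ℝ (Fin m)) : ℂ :=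
  MvPolynomial.eval (fun i ↦ (x i : ℂ)) P

end

/-! Write Δ_S for the Laplace–Beltrami operator of the round sphere and λ_k = −k(k+n−1). If G
extends f and is homogeneous of degree k, splitting the flat Laplacian into tangential and radial
directions and using Euler's identity gives Δ_S f = ΔG + λ_k f
(`laplaceBeltrami_of_isPosHomogeneous`). The product rule gives Δ_S(f²) = 2f Δ_S f + 2 g(grad f,
grad f) (`laplaceBeltrami_sq`). So once Δ_S f = λf, the gradient equation says exactly that f² is an
eigenfunction with eigenvalue 2λ+2μ. If P and P² are harmonic and P has degree d, both equations
follow at once.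

Conversely, a nonzero eigenfunction f is the restriction of a harmonic homogeneous H
(`exists_harmonic_polynomial`). Green's identity on the sphere turns the eigenvalue equation into a
recursion on the integrals of f against homogeneous polynomials, lowering the degree by 2. By
density of polynomials, f is determined by these integrals in the one degree d with λ = λ_d.

The gradient equation then reads Δ(H²) = cH² on the sphere for some constant c, that is |x|² Δ(H²) =
cH² as polynomials. If c ≠ 0, then |x|² divides H²; as |x|² is squarefree, it divides H. But a
harmonic H is orthogonal on the sphere to all polynomials of lower degree, so a multiple of |x|² can
be harmonic only if it is 0. In every case Δ(H²) = 0 (`polyLaplacian_sq_eq_zero`). -/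

noncomputable section

/-! ### The Laplace–Beltrami operator in stereographic coordinates -/

section Stereographic

variable {n : ℕ}

/-- The isometric embedding of the model space onto the hyperplane orthogonal to `x` which is used
by the preferred chart of the sphere around `x`. -/
def tangentFrame (x : unitSphere n) :
    EuclideanSpace ℝ (Fin n) →ₗᵢ[ℝ] EuclideanSpace ℝ (Fin (n + 1)) :=
  have := Fact.mk (@finrank_euclideanSpace_fin ℝ _ (n + 1))
  (ℝ ∙ ((-x : unitSphere n) : EuclideanSpace ℝ (Fin (n + 1))))ᗮ.subtypeₗᵢ.comp
    (OrthonormalBasis.fromOrthogonalSpanSingleton n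
      (ne_zero_of_mem_unit_sphere (-x))).repr.symm.toLinearIsometry

theorem inner_tangentFrame (x : unitSphere n) (y : EuclideanSpace ℝ (Fin n)) :
    inner ℝ (tangentFrame x y) (x : EuclideanSpace ℝ (Fin (n + 1))) = 0 := by
  have := Fact.mk (@finrank_euclideanSpace_fin ℝ _ (n + 1))
  have h := ((OrthonormalBasis.fromOrthogonalSpanSingleton n
      (ne_zero_of_mem_unit_sphere (-x))).repr.symm y).2
  rw [Submodule.mem_orthogonal_singleton_iff_inner_left] at h
  have h2 : inner ℝ (tangentFrame x y) (-(x : EuclideanSpace ℝ (Fin (n + 1)))) = 0 := h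
  rwa [inner_neg_right, neg_eq_zero] at h2

/-- The inverse of the stereographic chart around `x`, as a map into the ambient space. -/
def stereoParam (x : unitSphere n) (y : EuclideanSpace ℝ (Fin n)) :
    EuclideanSpace ℝ (Fin (n + 1)) :=
  (‖y‖ ^ 2 + 4)⁻¹ • ((4 : ℝ) • tangentFrame x y +
    (4 - ‖y‖ ^ 2) • (x : EuclideanSpace ℝ (Fin (n + 1))))

theorem coe_chartAt_symm (x : unitSphere n) (y : EuclideanSpace ℝ (Fin n)) :
    ((chartAt (EuclideanSpace ℝ (Fin n)) x).symm y : EuclideanSpace ℝ (Fin (n + 1))) =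
      stereoParam x y := by
  have := Fact.mk (@finrank_euclideanSpace_fin ℝ _ (n + 1))
  refine (stereographic'_symm_apply (-x) y).trans ?_
  have h : ‖(((OrthonormalBasis.fromOrthogonalSpanSingleton n
      (ne_zero_of_mem_unit_sphere (-x))).repr.symm y :
        (ℝ ∙ ((-x : unitSphere n) : EuclideanSpace ℝ (Fin (n + 1))))ᗮ) :
        EuclideanSpace ℝ (Fin (n + 1)))‖ = ‖y‖ := by
    rw [← Submodule.coe_norm, LinearIsometryEquiv.norm_map]
  simp only [h]
  simp only [stereoParam, tangentFrame]
  rw [← smul_add]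
  congr 2
  rw [coe_neg_sphere, smul_neg, ← neg_smul, neg_sub]

theorem chartAt_target (x : unitSphere n) :
    (chartAt (EuclideanSpace ℝ (Fin n)) x).target = Set.univ := by
  have := Fact.mk (@finrank_euclideanSpace_fin ℝ _ (n + 1))
  exact stereographic'_target (-x)

theorem norm_coe_unitSphere (x : unitSphere n) :
    ‖(x : EuclideanSpace ℝ (Fin (n + 1)))‖ = 1 := norm_eq_of_mem_sphere x

theorem stereoParam_zero (x : unitSphere n) : stereoParam x 0 = x := by
  simp [stereoParam, smul_smul]

/-- The chart around x projects from the antipode −x, so x sits at the origin and every chart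
computation at x takes place at 0. -/
theorem chartAt_self (x : unitSphere n) : chartAt (EuclideanSpace ℝ (Fin n)) x x = 0 := by
  have h : (chartAt (EuclideanSpace ℝ (Fin n)) x).symm 0 = x :=
    Subtype.ext ((coe_chartAt_symm x 0).trans (stereoParam_zero x))
  rw [← (chartAt (EuclideanSpace ℝ (Fin n)) x).right_inv
    (by rw [chartAt_target]; trivial : (0 : EuclideanSpace ℝ (Fin n)) ∈ _), h]

theorem contDiff_norm_sq_add_four_inv {k : ℕ∞ω} :
    ContDiff ℝ k fun y : EuclideanSpace ℝ (Fin n) ↦ (‖y‖ ^ 2 + 4)⁻¹ :=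
  ((contDiff_norm_sq ℝ).add contDiff_const).inv fun y ↦ by positivity

theorem contDiff_stereoParam {k : ℕ∞ω} (x : unitSphere n) : ContDiff ℝ k (stereoParam x) :=
  contDiff_norm_sq_add_four_inv.smul (((tangentFrame x).contDiff.const_smul _).add
    ((contDiff_const.sub (contDiff_norm_sq ℝ)).smul contDiff_const))

/-- The directional derivative of `stereoParam`. -/
theorem fderiv_stereoParam (x : unitSphere n) (y h : EuclideanSpace ℝ (Fin n)) :
    fderiv ℝ (stereoParam x) y h =
      (‖y‖ ^ 2 + 4)⁻¹ • ((4 : ℝ) • tangentFrame x h -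
        (2 * inner ℝ y h) • (x : EuclideanSpace ℝ (Fin (n + 1)))) -
      (2 * inner ℝ y h * ((‖y‖ ^ 2 + 4) ^ 2)⁻¹) • ((4 : ℝ) • tangentFrame x y +
        (4 - ‖y‖ ^ 2) • (x : EuclideanSpace ℝ (Fin (n + 1)))) := by
  have hn : HasFDerivAt (fun y : EuclideanSpace ℝ (Fin n) ↦ ‖y‖ ^ 2) (2 • innerSL ℝ y) y :=
    (hasStrictFDerivAt_norm_sq y).hasFDerivAt
  have h1 : HasFDerivAt (fun y : EuclideanSpace ℝ (Fin n) ↦ (‖y‖ ^ 2 + 4)⁻¹)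
      (-((‖y‖ ^ 2 + 4) ^ 2)⁻¹ • (2 • innerSL ℝ y)) y :=
    (hasDerivAt_inv (by positivity)).comp_hasFDerivAt y (hn.add_const 4)
  have h2 : HasFDerivAt (fun y : EuclideanSpace ℝ (Fin n) ↦ (4 : ℝ) • tangentFrame x y +
      (4 - ‖y‖ ^ 2) • (x : EuclideanSpace ℝ (Fin (n + 1))))
      ((4 : ℝ) • (tangentFrame x).toContinuousLinearMap +
        (-(2 • innerSL ℝ y)).smulRight (x : EuclideanSpace ℝ (Fin (n + 1)))) y :=
    ((tangentFrame x).toContinuousLinearMap.hasFDerivAt.fun_const_smul (4 : ℝ)).fun_add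
      ((hn.const_sub 4).smul_const _)
  unfold stereoParam
  rw [(h1.fun_smul h2).fderiv]
  simp
  module

theorem inner_fderiv_stereoParam (x : unitSphere n) (y h k : EuclideanSpace ℝ (Fin n)) :
    inner ℝ (fderiv ℝ (stereoParam x) y h) (fderiv ℝ (stereoParam x) y k) =
      16 * ((‖y‖ ^ 2 + 4) ^ 2)⁻¹ * inner ℝ h k := by
  have hx : inner ℝ (x : EuclideanSpace ℝ (Fin (n + 1))) (x : EuclideanSpace ℝ (Fin (n + 1))) =
      (1 : ℝ) := by rw [real_inner_self_eq_norm_sq, norm_coe_unitSphere, one_pow]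
  have hs : ‖y‖ ^ 2 + 4 ≠ 0 := by positivity
  have h1 (z) := inner_tangentFrame x z
  have h2 (z) : inner ℝ (x : EuclideanSpace ℝ (Fin (n + 1))) (tangentFrame x z) = (0 : ℝ) := by
    rw [real_inner_comm, h1]
  simp only [fderiv_stereoParam, inner_add_left, inner_add_right, inner_sub_left, inner_sub_right,
    real_inner_smul_left, real_inner_smul_right, LinearIsometry.inner_map_map, h1, h2, hx,
    real_inner_self_eq_norm_sq, real_inner_comm y]
  field_simp
  ring

theorem contMDiff_chartAt_symm {k : ℕ∞ω} (x : unitSphere n) :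
    ContMDiff (𝓡 n) (𝓡 n) k (chartAt (EuclideanSpace ℝ (Fin n)) x).symm := by
  have h : ContMDiffOn (𝓡 n) (𝓡 n) ω (chartAt (EuclideanSpace ℝ (Fin n)) x).symm
    (chartAt (EuclideanSpace ℝ (Fin n)) x).target := contMDiffOn_chart_symm
  rw [chartAt_target, contMDiffOn_univ] at h
  exact h.of_le le_top

theorem inclusionDeriv_coordVector (x : unitSphere n) (y : EuclideanSpace ℝ (Fin n)) (i : Fin n) :
    inclusionDeriv n _ (coordVector x y i) =
      fderiv ℝ (stereoParam x) y (EuclideanSpace.single i 1) := by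
  have := Fact.mk (@finrank_euclideanSpace_fin ℝ _ (n + 1))
  have h1 : MDifferentiableAt (𝓡 n) (𝓡 n) (chartAt (EuclideanSpace ℝ (Fin n)) x).symm y :=
    (contMDiff_chartAt_symm (k := 1) x).mdifferentiableAt one_ne_zero
  have h2 : MDifferentiableAt (𝓡 n) 𝓘(ℝ, EuclideanSpace ℝ (Fin (n + 1)))
      (Subtype.val : unitSphere n → EuclideanSpace ℝ (Fin (n + 1)))
      ((chartAt (EuclideanSpace ℝ (Fin n)) x).symm y) :=
    (contMDiff_coe_sphere (m := 1)).mdifferentiableAt one_ne_zero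
  have h3 := mfderiv_comp_apply y h2 h1 (EuclideanSpace.single i (1 : ℝ) : EuclideanSpace ℝ (Fin n))
  have h4 : (Subtype.val : unitSphere n → EuclideanSpace ℝ (Fin (n + 1))) ∘
      (chartAt (EuclideanSpace ℝ (Fin n)) x).symm = stereoParam x :=
    funext (coe_chartAt_symm x)
  rw [h4, mfderiv_eq_fderiv] at h3
  exact h3.symm

/-- Stereographic projection is conformal. -/
theorem metricMatrix_roundMetric (x : unitSphere n) (y : EuclideanSpace ℝ (Fin n)) :
    metricMatrix (roundMetric n) x y =
      (16 * ((‖y‖ ^ 2 + 4) ^ 2)⁻¹) • (1 : Matrix (Fin n) (Fin n) ℝ) := by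
  ext i j
  rw [metricMatrix, Matrix.of_apply]
  change roundInner n _ _ _ = _
  rw [roundInner_apply, inclusionDeriv_coordVector, inclusionDeriv_coordVector,
    inner_fderiv_stereoParam]
  rw [EuclideanSpace.inner_single_left]
  simp [Matrix.one_apply]

theorem volumeDensity_roundMetric (x : unitSphere n) (y : EuclideanSpace ℝ (Fin n)) :
    volumeDensity (roundMetric n) x y = (4 * (‖y‖ ^ 2 + 4)⁻¹) ^ n := by
  rw [volumeDensity, metricMatrix_roundMetric, Matrix.det_smul, Matrix.det_one, mul_one,
    Fintype.card_fin, Real.sqrt_eq_iff_mul_self_eq (by positivity) (by positivity), ← mul_pow]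
  congr 1
  rw [← inv_pow]
  ring

theorem metricMatrix_roundMetric_inv (x : unitSphere n) (y : EuclideanSpace ℝ (Fin n)) :
    (metricMatrix (roundMetric n) x y)⁻¹ =
      ((‖y‖ ^ 2 + 4) ^ 2 / 16) • (1 : Matrix (Fin n) (Fin n) ℝ) := by
  refine Matrix.inv_eq_left_inv ?_
  rw [metricMatrix_roundMetric, smul_mul_smul_comm, mul_one]
  have : ‖y‖ ^ 2 + 4 ≠ 0 := by positivity
  rw [show (‖y‖ ^ 2 + 4) ^ 2 / 16 * (16 * ((‖y‖ ^ 2 + 4) ^ 2)⁻¹) = 1 by field_simp, one_smul]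

theorem gradComponent_roundMetric (f : unitSphere n → ℂ) (x : unitSphere n) (i : Fin n)
    (y : EuclideanSpace ℝ (Fin n)) :
    gradComponent (roundMetric n) f x i y = ((‖y‖ ^ 2 + 4) ^ 2 / 16 : ℝ) *
      partialDeriv i (f ∘ (chartAt (EuclideanSpace ℝ (Fin n)) x).symm) y := by
  rw [gradComponent, metricMatrix_roundMetric_inv, Finset.sum_eq_single i]
  · simp
  · intro j _ hj
    simp [Matrix.one_apply_ne hj.symm]
  · simp

/-- In the stereographic chart around `x`, the Laplace–Beltrami operator at `x` is the flat
Laplacian. -/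
theorem laplaceBeltrami_eq_sum (f : unitSphere n → ℂ) (x : unitSphere n)
    (hf : ContDiff ℝ 2 (f ∘ (chartAt (EuclideanSpace ℝ (Fin n)) x).symm)) :
    laplaceBeltrami (roundMetric n) f x =
      ∑ i, partialDeriv i
        (partialDeriv i (f ∘ (chartAt (EuclideanSpace ℝ (Fin n)) x).symm)) 0 := by
  rw [laplaceBeltrami, chartAt_self, volumeDensity_roundMetric]
  rw [show ((4 : ℝ) * (‖(0 : EuclideanSpace ℝ (Fin n))‖ ^ 2 + 4)⁻¹) ^ n = 1 by simp]
  rw [Complex.ofReal_one, inv_one, one_mul]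
  refine Finset.sum_congr rfl fun i _ ↦ ?_
  set u := f ∘ (chartAt (EuclideanSpace ℝ (Fin n)) x).symm
  have hfun : (fun y ↦ (volumeDensity (roundMetric n) x y : ℂ) *
      gradComponent (roundMetric n) f x i y) = fun y ↦
      ((4 * (‖y‖ ^ 2 + 4)⁻¹) ^ n * ((‖y‖ ^ 2 + 4) ^ 2 / 16) : ℝ) • partialDeriv i u y := by
    ext y
    rw [volumeDensity_roundMetric, gradComponent_roundMetric, Complex.real_smul]
    push_cast
    ring
  rw [hfun]
  have hn : HasFDerivAt (fun y : EuclideanSpace ℝ (Fin n) ↦ ‖y‖ ^ 2)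
      (0 : EuclideanSpace ℝ (Fin n) →L[ℝ] ℝ) 0 := by
    convert! (hasStrictFDerivAt_norm_sq (0 : EuclideanSpace ℝ (Fin n))).hasFDerivAt using 1
    simp
  -- The coefficient depends only on ‖y‖², hence is critical at 0: no first-order term survives in
  -- the operator.
  have ha : HasFDerivAt (fun y : EuclideanSpace ℝ (Fin n) ↦
      (4 * (‖y‖ ^ 2 + 4)⁻¹) ^ n * ((‖y‖ ^ 2 + 4) ^ 2 / 16))
      (0 : EuclideanSpace ℝ (Fin n) →L[ℝ] ℝ) 0 := by
    have hd : DifferentiableAt ℝ (fun t : ℝ ↦ (4 * (t + 4)⁻¹) ^ n * ((t + 4) ^ 2 / 16))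
        (‖(0 : EuclideanSpace ℝ (Fin n))‖ ^ 2) := by
      have : ‖(0 : EuclideanSpace ℝ (Fin n))‖ ^ 2 + 4 ≠ 0 := by simp
      fun_prop (disch := assumption)
    have := hd.hasDerivAt.comp_hasFDerivAt (0 : EuclideanSpace ℝ (Fin n)) hn
    rw [smul_zero] at this
    exact this
  have hu : DifferentiableAt ℝ (partialDeriv i u) 0 := by
    have h1 : ContDiff ℝ 1 (fderiv ℝ u) := hf.fderiv_right le_rfl
    exact ((h1.differentiable one_ne_zero).clm_apply (differentiable_const _)) 0
  unfold partialDeriv at hu ⊢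
  rw [(ha.fun_smul hu.hasFDerivAt).fderiv]
  norm_num

theorem gradInner_eq_sum (f : unitSphere n → ℂ) (x : unitSphere n) :
    gradInner (roundMetric n) f f x =
      ∑ i, partialDeriv i (f ∘ (chartAt (EuclideanSpace ℝ (Fin n)) x).symm) 0 ^ 2 := by
  rw [gradInner, chartAt_self]
  refine Finset.sum_congr rfl fun i _ ↦ ?_
  rw [Finset.sum_eq_single i]
  · rw [metricMatrix_roundMetric, gradComponent_roundMetric]
    norm_num
    ring
  · intro j _ hj
    rw [metricMatrix_roundMetric]
    simp [Matrix.one_apply_ne hj.symm]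
  · simp

theorem contDiff_comp_chartAt_symm {f : unitSphere n → ℂ} {k : ℕ∞ω}
    (hf : ContMDiff (𝓡 n) 𝓘(ℝ, ℂ) k f) (x : unitSphere n) :
    ContDiff ℝ k (f ∘ (chartAt (EuclideanSpace ℝ (Fin n)) x).symm) :=
  (hf.comp (contMDiff_chartAt_symm x)).contDiff

/-- The product rule at the centre of the chart. It trades the nonlinear gradient condition on f for
a linear equation for f². -/
theorem laplaceBeltrami_sq {f : unitSphere n → ℂ} (hf : ContMDiff (𝓡 n) 𝓘(ℝ, ℂ) 2 f)
    (x : unitSphere n) :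
    laplaceBeltrami (roundMetric n) (fun y ↦ f y ^ 2) x =
      2 * f x * laplaceBeltrami (roundMetric n) f x + 2 * gradInner (roundMetric n) f f x := by
  have hu := contDiff_comp_chartAt_symm hf x
  have hx : (chartAt (EuclideanSpace ℝ (Fin n)) x).symm 0 = x :=
    Subtype.ext ((coe_chartAt_symm x 0).trans (stereoParam_zero x))
  rw [laplaceBeltrami_eq_sum _ _ hu, gradInner_eq_sum, laplaceBeltrami_eq_sum, Finset.mul_sum,
    Finset.mul_sum, ← Finset.sum_add_distrib]
  swap
  · exact hu.pow 2
  refine Finset.sum_congr rfl fun i _ ↦ ?_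
  rw [show (fun y ↦ f y ^ 2) ∘ (chartAt (EuclideanSpace ℝ (Fin n)) x).symm =
    fun y ↦ (f ∘ (chartAt (EuclideanSpace ℝ (Fin n)) x).symm) y ^ 2 from rfl]
  rw [show f x = (f ∘ (chartAt (EuclideanSpace ℝ (Fin n)) x).symm) 0 by
    rw [Function.comp_apply, hx]]
  generalize f ∘ (chartAt (EuclideanSpace ℝ (Fin n)) x).symm = u at hu
  have hd := hu.differentiable two_ne_zero
  have h1 : partialDeriv i (fun y ↦ u y ^ 2) = fun y ↦ 2 * u y * partialDeriv i u y := by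
    ext y
    unfold partialDeriv
    rw [((hd y).hasFDerivAt.pow 2).fderiv]
    simp
  have hd2 : DifferentiableAt ℝ (partialDeriv i u) 0 := by
    have h1 : ContDiff ℝ 1 (fderiv ℝ u) := hu.fderiv_right le_rfl
    exact ((h1.differentiable one_ne_zero).clm_apply (differentiable_const _)) 0
  rw [h1]
  have h2 := (((hd 0).hasFDerivAt.const_mul (2 : ℂ)).fun_mul hd2.hasFDerivAt).fderiv
  rw [partialDeriv, h2]
  simp [partialDeriv]
  ring

end Stereographic

/-! ### Comparison with the flat Laplacian of an extension -/

section Extension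

variable {n : ℕ}

theorem fderiv_stereoParam_zero (x : unitSphere n) (h : EuclideanSpace ℝ (Fin n)) :
    fderiv ℝ (stereoParam x) 0 h = tangentFrame x h := by
  rw [fderiv_stereoParam]
  simp [smul_smul]

/-- The second derivative of the parametrization at 0 is (h, k) ↦ −⟨h, k⟩x, the second fundamental
form of the sphere. It has no tangential part, since the metric is Euclidean to first order at 0. -/
theorem hasFDerivAt_fderiv_stereoParam_zero (x : unitSphere n) (h : EuclideanSpace ℝ (Fin n)) :
    HasFDerivAt (fun y ↦ fderiv ℝ (stereoParam x) y h)
      ((-innerSL ℝ h).smulRight (x : EuclideanSpace ℝ (Fin (n + 1)))) 0 := by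
  simp only [fderiv_stereoParam]
  have hn : HasFDerivAt (fun y : EuclideanSpace ℝ (Fin n) ↦ ‖y‖ ^ 2)
      (0 : EuclideanSpace ℝ (Fin n) →L[ℝ] ℝ) 0 := by
    convert! (hasStrictFDerivAt_norm_sq (0 : EuclideanSpace ℝ (Fin n))).hasFDerivAt using 1
    simp
  have hi : HasFDerivAt (fun y : EuclideanSpace ℝ (Fin n) ↦ 2 * inner ℝ y h)
      ((2 : ℝ) • innerSL ℝ h) 0 := by
    simp only [real_inner_comm h]
    exact (innerSL ℝ h).hasFDerivAt.const_mul 2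
  have hs : HasFDerivAt (fun y : EuclideanSpace ℝ (Fin n) ↦ (‖y‖ ^ 2 + 4)⁻¹)
      (0 : EuclideanSpace ℝ (Fin n) →L[ℝ] ℝ) 0 := by
    have := (hasDerivAt_inv (by positivity)).comp_hasFDerivAt (0 : EuclideanSpace ℝ (Fin n))
      (hn.add_const 4)
    rwa [smul_zero] at this
  have hs2 : HasFDerivAt (fun y : EuclideanSpace ℝ (Fin n) ↦ ((‖y‖ ^ 2 + 4) ^ 2)⁻¹)
      (0 : EuclideanSpace ℝ (Fin n) →L[ℝ] ℝ) 0 := by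
    simp only [← inv_pow]
    have := hs.pow 2
    rwa [smul_zero] at this
  have hv := ((hn.const_sub 4).smul_const (x : EuclideanSpace ℝ (Fin (n + 1))))
  have hw : HasFDerivAt (fun y : EuclideanSpace ℝ (Fin n) ↦ (4 : ℝ) • tangentFrame x y +
      (4 - ‖y‖ ^ 2) • (x : EuclideanSpace ℝ (Fin (n + 1)))) _ 0 :=
    ((tangentFrame x).toContinuousLinearMap.hasFDerivAt.fun_const_smul (4 : ℝ)).fun_add hv
  refine ((hs.fun_smul ((hi.smul_const _).const_sub _)).fun_sub
    ((hi.fun_mul hs2).fun_smul hw)).congr_fderiv ?_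
  ext1 k
  simp
  module

/-- The orthonormal basis of the ambient space formed by `x` and a tangent frame at `x`. -/
def adaptedBasis (x : unitSphere n) :
    OrthonormalBasis (Fin (n + 1)) ℝ (EuclideanSpace ℝ (Fin (n + 1))) :=
  have hon : Orthonormal ℝ (Fin.cons (x : EuclideanSpace ℝ (Fin (n + 1)))
      (fun i ↦ tangentFrame x (EuclideanSpace.single i 1)) :
      Fin (n + 1) → EuclideanSpace ℝ (Fin (n + 1))) := by
    rw [orthonormal_iff_ite]
    intro i j
    refine Fin.cases ?_ (fun i ↦ ?_) i <;> refine Fin.cases ?_ (fun j ↦ ?_) j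
    · simp
    · rw [real_inner_comm]
      simpa [Fin.succ_ne_zero, eq_comm] using inner_tangentFrame x _
    · simpa [Fin.succ_ne_zero, eq_comm] using inner_tangentFrame x _
    · simp only [Fin.cons_succ, LinearIsometry.inner_map_map, EuclideanSpace.inner_single_left]
      simp [Fin.succ_inj]
  OrthonormalBasis.mk hon
    (hon.linearIndependent.span_eq_top_of_card_eq_finrank (by simp)).ge

theorem laplacian_eq_add_sum_tangentFrame (G : EuclideanSpace ℝ (Fin (n + 1)) → ℂ)
    (x : unitSphere n) :
    Δ G x = fderiv ℝ (fderiv ℝ G) x x x +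
      ∑ i, fderiv ℝ (fderiv ℝ G) x (tangentFrame x (EuclideanSpace.single i 1))
        (tangentFrame x (EuclideanSpace.single i 1)) := by
  rw [laplacian_eq_iteratedFDeriv_orthonormalBasis G (adaptedBasis x)]
  simp only [iteratedFDeriv_two_apply, Fin.sum_univ_succ]
  simp [adaptedBasis]

/-- The Laplace–Beltrami operator of the sphere in terms of an extension to the ambient space. -/
theorem laplaceBeltrami_eq_of_extension {f : unitSphere n → ℂ}
    (hf : ContMDiff (𝓡 n) 𝓘(ℝ, ℂ) 2 f) {G : EuclideanSpace ℝ (Fin (n + 1)) → ℂ}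
    (hG : ∀ y : unitSphere n, G y = f y) (x : unitSphere n) (hx : ContDiffAt ℝ 2 G x) :
    laplaceBeltrami (roundMetric n) f x =
      Δ G x - fderiv ℝ (fderiv ℝ G) x x x - n * fderiv ℝ G x x := by
  rw [laplaceBeltrami_eq_sum _ _ (contDiff_comp_chartAt_symm hf x),
    laplacian_eq_add_sum_tangentFrame, add_sub_cancel_left]
  have hu : f ∘ (chartAt (EuclideanSpace ℝ (Fin n)) x).symm = G ∘ stereoParam x := by
    ext y
    rw [Function.comp_apply, Function.comp_apply, ← hG, coe_chartAt_symm]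
  rw [hu]
  have hΨ : Differentiable ℝ (stereoParam x) :=
    (contDiff_stereoParam (k := 1) x).differentiable one_ne_zero
  have hev : ∀ᶠ y in nhds (0 : EuclideanSpace ℝ (Fin n)),
      DifferentiableAt ℝ G (stereoParam x y) := by
    have h1 : ∀ᶠ z in nhds (x : EuclideanSpace ℝ (Fin (n + 1))), DifferentiableAt ℝ G z :=
      (hx.eventually (by simp)).mono fun z hz ↦ hz.differentiableAt two_ne_zero
    refine hΨ.continuous.continuousAt.eventually ?_
    rwa [stereoParam_zero]
  have hG' : DifferentiableAt ℝ (fderiv ℝ G) (stereoParam x 0) := by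
    rw [stereoParam_zero]
    exact (hx.fderiv_right (m := 1) le_rfl).differentiableAt one_ne_zero
  -- Second-order chain rule: curvature contributes −G'(x)x in each of the n frame directions,
  -- whence the term with factor n.
  have key : ∀ i : Fin n, partialDeriv i (partialDeriv i (G ∘ stereoParam x)) 0 =
      fderiv ℝ (fderiv ℝ G) x (tangentFrame x (EuclideanSpace.single i 1))
        (tangentFrame x (EuclideanSpace.single i 1)) - fderiv ℝ G x x := by
    intro i
    have h1 : partialDeriv i (G ∘ stereoParam x) =ᶠ[nhds 0] fun y ↦
        fderiv ℝ G (stereoParam x y) (fderiv ℝ (stereoParam x) y (EuclideanSpace.single i 1)) := by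
      filter_upwards [hev] with y hy
      rw [partialDeriv, fderiv_comp y hy (hΨ y)]
      rfl
    have h2 := (hG'.hasFDerivAt.comp (0 : EuclideanSpace ℝ (Fin n)) (hΨ 0).hasFDerivAt).clm_apply
      (hasFDerivAt_fderiv_stereoParam_zero x (EuclideanSpace.single i 1))
    have h3 : partialDeriv i (partialDeriv i (G ∘ stereoParam x)) 0 = _ :=
      congrArg (· (EuclideanSpace.single i (1 : ℝ))) (h1.fderiv_eq.trans h2.fderiv)
    rw [h3]
    simp [fderiv_stereoParam_zero, stereoParam_zero]
    ring
  simp only [key, Finset.sum_sub_distrib]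
  simp

/-- Positive homogeneity of degree `k`: `G (t x) = tᵏ G x` for `t > 0`. -/
def IsPosHomogeneous {m : ℕ} (k : ℕ) (G : EuclideanSpace ℝ (Fin m) → ℂ) : Prop :=
  ∀ (t : ℝ) (x : EuclideanSpace ℝ (Fin m)), 0 < t → G (t • x) = (t : ℂ) ^ k * G x

/-- Euler's identity: differentiate G(tx) = tᵏG(x) at t = 1. -/
theorem IsPosHomogeneous.fderiv_self {m k : ℕ} {G : EuclideanSpace ℝ (Fin m) → ℂ}
    (hG : IsPosHomogeneous k G) {x : EuclideanSpace ℝ (Fin m)} (hx : DifferentiableAt ℝ G x) :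
    fderiv ℝ G x x = k * G x := by
  have h1 : HasDerivAt (fun t : ℝ ↦ G (t • x)) (fderiv ℝ G x x) 1 := by
    have h2 : HasDerivAt (fun t : ℝ ↦ t • x) ((1 : ℝ) • x) 1 := (hasDerivAt_id 1).smul_const x
    rw [one_smul] at h2
    have h3 : HasFDerivAt G (fderiv ℝ G x) ((1 : ℝ) • x) := by
      rw [one_smul]; exact hx.hasFDerivAt
    exact h3.comp_hasDerivAt 1 h2
  have h4 : HasDerivAt (fun t : ℝ ↦ (t : ℂ) ^ k * G x) (k * G x) 1 := by
    have := ((hasDerivAt_pow k (1 : ℂ)).comp_ofReal (z := 1)).mul_const (G x)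
    simpa using this
  refine h1.unique (h4.congr_of_eventuallyEq ?_)
  filter_upwards [lt_mem_nhds one_pos] with t ht using hG t x ht

/-- Differentiating Euler's identity at x in the direction x gives D²G(x, x) + DG(x) = k DG(x). -/
theorem IsPosHomogeneous.fderiv_fderiv_self {m k : ℕ} {G : EuclideanSpace ℝ (Fin m) → ℂ}
    (hG : IsPosHomogeneous k G) {x : EuclideanSpace ℝ (Fin m)} (hx : ContDiffAt ℝ 2 G x) :
    fderiv ℝ (fderiv ℝ G) x x x = k * (k - 1) * G x := by
  have h1 : (fun y ↦ fderiv ℝ G y y) =ᶠ[nhds x] fun y ↦ k * G y :=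
    (hx.eventually (by simp)).mono fun z hz ↦ hG.fderiv_self (hz.differentiableAt two_ne_zero)
  have h2 : DifferentiableAt ℝ (fderiv ℝ G) x :=
    (hx.fderiv_right (m := 1) le_rfl).differentiableAt one_ne_zero
  have hd := hx.differentiableAt two_ne_zero
  have h3 := congrArg (· x) ((h2.hasFDerivAt.clm_apply (hasFDerivAt_id x)).fderiv.symm.trans
    (h1.fderiv_eq.trans (hd.hasFDerivAt.const_mul (k : ℂ)).fderiv))
  simp [hG.fderiv_self hd] at h3
  linear_combination h3

/-- The eigenvalue of the Laplace–Beltrami operator on spherical harmonics of degree `k`. -/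
def sphereEigenvalue (n k : ℕ) : ℂ := -(k * (k + n - 1))

/-- The radial terms add up to k(k−1) + nk = k(k+n−1). The case k = 0 serves extensions constant
along rays, the general case polynomials. -/
theorem laplaceBeltrami_of_isPosHomogeneous {f : unitSphere n → ℂ}
    (hf : ContMDiff (𝓡 n) 𝓘(ℝ, ℂ) 2 f) {k : ℕ} {G : EuclideanSpace ℝ (Fin (n + 1)) → ℂ}
    (hG : ∀ y : unitSphere n, G y = f y) (hk : IsPosHomogeneous k G) (x : unitSphere n)
    (hx : ContDiffAt ℝ 2 G x) :
    laplaceBeltrami (roundMetric n) f x = Δ G x + sphereEigenvalue n k * f x := by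
  rw [laplaceBeltrami_eq_of_extension hf hG x hx, hk.fderiv_fderiv_self hx,
    hk.fderiv_self (hx.differentiableAt two_ne_zero), hG, sphereEigenvalue]
  ring

end Extension

/-! ### Green's identity on the sphere, from the divergence theorem in the ambient space -/

section Green

open MeasureTheory

variable {n : ℕ}

/-- The extension of a function on the sphere which is constant along rays (and `0` at `0`). -/
def radialExtension (f : unitSphere n → ℂ) (x : EuclideanSpace ℝ (Fin (n + 1))) : ℂ :=
  open Classical in
  if hx : x = 0 then 0 else f ⟨‖x‖⁻¹ • x, by simp [norm_smul, hx]⟩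

theorem radialExtension_coe (f : unitSphere n → ℂ) (x : unitSphere n) :
    radialExtension f x = f x := by
  have hx : (x : EuclideanSpace ℝ (Fin (n + 1))) ≠ 0 := ne_zero_of_mem_unit_sphere x
  rw [radialExtension, dif_neg hx]
  congr 1
  ext1
  simp

theorem radialExtension_smul (f : unitSphere n → ℂ) {t : ℝ} (ht : 0 < t)
    (x : EuclideanSpace ℝ (Fin (n + 1))) : radialExtension f (t • x) = radialExtension f x := by
  by_cases hx : x = 0
  · simp [hx]
  · rw [radialExtension, radialExtension, dif_neg (smul_ne_zero ht.ne' hx), dif_neg hx]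
    congr 2
    rw [norm_smul, Real.norm_eq_abs, abs_of_pos ht, smul_smul]
    congr 1
    field_simp

theorem isPosHomogeneous_radialExtension (f : unitSphere n → ℂ) :
    IsPosHomogeneous 0 (radialExtension f) := fun t x ht ↦ by
  rw [radialExtension_smul f ht, pow_zero, one_mul]

/-- Near x the extension is f read in a chart, composed with the chart and z ↦ z/‖z‖. Replacing the
chart by the ambient formula `stereoToFun` leaves only maps between vector spaces. -/
theorem contDiffAt_radialExtension {f : unitSphere n → ℂ} {k : ℕ∞ω}
    (hf : ContMDiff (𝓡 n) 𝓘(ℝ, ℂ) k f) {x : EuclideanSpace ℝ (Fin (n + 1))} (hx : x ≠ 0) :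
    ContDiffAt ℝ k (radialExtension f) x := by
  have := Fact.mk (@finrank_euclideanSpace_fin ℝ _ (n + 1))
  let p : unitSphere n := ⟨‖x‖⁻¹ • x, by simp [norm_smul, hx]⟩
  let U := (OrthonormalBasis.fromOrthogonalSpanSingleton n (𝕜 := ℝ)
      (ne_zero_of_mem_unit_sphere (-p))).repr
  let N : EuclideanSpace ℝ (Fin (n + 1)) → EuclideanSpace ℝ (Fin (n + 1)) := fun z ↦ ‖z‖⁻¹ • z
  have hN : ContDiffAt ℝ k N x :=
    ((contDiffAt_norm ℝ hx).inv (norm_ne_zero_iff.2 hx)).smul contDiffAt_id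
  have hpx : N x = p := rfl
  -- `stereoToFun` with pole −p is smooth off the hyperplane ⟨−p, z⟩ = 1; at p this product is −1.
  have hne : innerSL ℝ ((-p : unitSphere n) : EuclideanSpace ℝ (Fin (n + 1))) (N x) ≠ (1 : ℝ) := by
    rw [hpx, innerSL_apply_apply, coe_neg_sphere, inner_neg_left, real_inner_self_eq_norm_sq,
      norm_coe_unitSphere]
    norm_num
  have hopen : IsOpen {z : EuclideanSpace ℝ (Fin (n + 1)) |
      innerSL ℝ ((-p : unitSphere n) : EuclideanSpace ℝ (Fin (n + 1))) z ≠ (1 : ℝ)} :=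
    isOpen_ne_fun (innerSL ℝ _).continuous continuous_const
  have hst : ContDiffAt ℝ k (stereoToFun ((-p : unitSphere n) : EuclideanSpace ℝ (Fin (n + 1))))
      (N x) := contDiffOn_stereoToFun.contDiffAt (hopen.mem_nhds hne)
  have hcomp : ContDiffAt ℝ k ((f ∘ (chartAt (EuclideanSpace ℝ (Fin n)) p).symm) ∘ U ∘
      stereoToFun ((-p : unitSphere n) : EuclideanSpace ℝ (Fin (n + 1))) ∘ N) x :=
    (contDiff_comp_chartAt_symm hf p).contDiffAt.comp x
      (U.contDiff.contDiffAt.comp x (hst.comp x hN))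
  refine hcomp.congr_of_eventuallyEq ?_
  filter_upwards [isOpen_ne.mem_nhds hx, hN.continuousAt (hopen.mem_nhds hne)] with z hz hz'
  rw [radialExtension, dif_neg hz]
  set q : unitSphere n := ⟨‖z‖⁻¹ • z, _⟩
  have hq : q ∈ (chartAt (EuclideanSpace ℝ (Fin n)) p).source := by
    change q ∈ (stereographic' n (-p)).source
    rw [stereographic'_source]
    intro h
    rw [Set.mem_singleton_iff] at h
    apply hz'
    change innerSL ℝ _ (q : EuclideanSpace ℝ (Fin (n + 1))) = 1
    rw [h, innerSL_apply_apply, real_inner_self_eq_norm_sq, norm_coe_unitSphere, one_pow]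
  exact congrArg f ((chartAt (EuclideanSpace ℝ (Fin n)) p).left_inv hq).symm

/-- Second derivatives of a function of degree 0 have degree −2. -/
theorem laplacian_smul_of_isPosHomogeneous_zero {m : ℕ} {G : EuclideanSpace ℝ (Fin m) → ℂ}
    (hG : IsPosHomogeneous 0 G) {t : ℝ} (ht : 0 < t) (x : EuclideanSpace ℝ (Fin m)) :
    Δ G x = (t : ℂ) ^ 2 * Δ G (t • x) := by
  have h0 : (fun y ↦ G (t • y)) = G := funext fun y ↦ by rw [hG t y ht, pow_zero, one_mul]
  have h1 (y) : fderiv ℝ G y = t • fderiv ℝ G (t • y) := by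
    conv_lhs => rw [← h0]
    exact fderiv_comp_smul t
  have h2 : fderiv ℝ (fderiv ℝ G) x = t • t • fderiv ℝ (fderiv ℝ G) (t • x) := by
    conv_lhs => rw [show fderiv ℝ G = t • fun y ↦ fderiv ℝ G (t • y) from funext h1]
    refine (congrFun (fderiv_const_smul_field (𝕜 := ℝ) (f := fun y ↦ fderiv ℝ G (t • y)) t) x).trans
      ?_
    rw [Pi.smul_apply, fderiv_comp_smul]
  simp only [laplacian_eq_iteratedFDeriv_stdOrthonormalBasis, iteratedFDeriv_two_apply, h2,
    Finset.mul_sum]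
  refine Finset.sum_congr rfl fun i _ ↦ ?_
  simp [pow_two, mul_assoc]

theorem laplacian_radialExtension {f : unitSphere n → ℂ}
    (hf : ContMDiff (𝓡 n) 𝓘(ℝ, ℂ) 2 f) {x : EuclideanSpace ℝ (Fin (n + 1))} (hx : x ≠ 0) :
    (‖x‖ ^ 2 : ℝ) * Δ (radialExtension f) x =
      radialExtension (laplaceBeltrami (roundMetric n) f) x := by
  have hx' : 0 < ‖x‖⁻¹ := by positivity
  have hhom := isPosHomogeneous_radialExtension f
  rw [radialExtension, dif_neg hx, laplaceBeltrami_of_isPosHomogeneous hf (radialExtension_coe f)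
    hhom _ (contDiffAt_radialExtension hf (ne_zero_of_mem_unit_sphere _)),
    laplacian_smul_of_isPosHomogeneous_zero hhom hx' x, ← mul_assoc]
  simp [sphereEigenvalue, hx]

/-- A smooth bump function on `(1, 3)`, used as a radial cutoff. -/
def radialBump : ContDiffBump (2 : ℝ) := ⟨1 / 2, 1, by norm_num, by norm_num⟩

theorem radialBump_eq_zero_of_le {t : ℝ} (ht : t ≤ 1) : radialBump t = 0 :=
  radialBump.zero_of_le_dist (by
    rw [Real.dist_eq, abs_of_nonpos (by linarith)]; change (1 : ℝ) ≤ _; linarith)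

theorem radialBump_eq_zero_of_ge {t : ℝ} (ht : 3 ≤ t) : radialBump t = 0 :=
  radialBump.zero_of_le_dist (by
    rw [Real.dist_eq, abs_of_nonneg (by linarith)]; change (1 : ℝ) ≤ _; linarith)

theorem hasCompactSupport_radialBump {m : ℕ} :
    HasCompactSupport fun x : EuclideanSpace ℝ (Fin m) ↦ radialBump (‖x‖ ^ 2) :=
  HasCompactSupport.intro (isCompact_closedBall 0 2) fun x hx ↦ by
    rw [mem_closedBall_zero_iff, not_le] at hx
    exact radialBump_eq_zero_of_ge (by nlinarith)

theorem continuous_radialBump {m : ℕ} :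
    Continuous fun x : EuclideanSpace ℝ (Fin m) ↦ radialBump (‖x‖ ^ 2) :=
  radialBump.continuous.comp (continuous_norm.pow 2)

/-- Integration in polar coordinates against the radial cutoff. -/
theorem integral_radialBump_mul_radialExtension (n : ℕ) : ∃ c : ℂ, c ≠ 0 ∧
    ∀ q : unitSphere n → ℂ,
      ∫ x : EuclideanSpace ℝ (Fin (n + 1)), (radialBump (‖x‖ ^ 2) : ℂ) * radialExtension q x =
        c * ∫ x, q x ∂(volume : Measure (EuclideanSpace ℝ (Fin (n + 1)))).toSphere := by
  let V := EuclideanSpace ℝ (Fin (n + 1))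
  let c : ℂ := ∫ r : Set.Ioi (0 : ℝ), (radialBump ((r : ℝ) ^ 2) : ℂ)
    ∂Measure.volumeIoiPow (Module.finrank ℝ V - 1)
  have key : ∀ q : unitSphere n → ℂ,
      ∫ x : V, (radialBump (‖x‖ ^ 2) : ℂ) * radialExtension q x =
        c * ∫ x, q x ∂(volume : Measure V).toSphere := by
    intro q
    calc _ = ∫ x : ({(0 : V)}ᶜ : Set V), (radialBump (‖x.1‖ ^ 2) : ℂ) * radialExtension q x.1
          ∂((volume : Measure V).comap (↑)) := by
          rw [integral_subtype_comap (measurableSet_singleton _).compl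
            fun x : V ↦ (radialBump (‖x‖ ^ 2) : ℂ) * radialExtension q x,
            restrict_compl_singleton]
      _ = ∫ x : ({(0 : V)}ᶜ : Set V), (fun z : sphere (0 : V) 1 × Set.Ioi (0 : ℝ) ↦
            q z.1 * (radialBump ((z.2 : ℝ) ^ 2) : ℂ)) (homeomorphUnitSphereProd V x)
          ∂((volume : Measure V).comap (↑)) := by
          refine integral_congr_ae (.of_forall fun x ↦ ?_)
          have hx : (x : V) ≠ 0 := x.2
          simp only [radialExtension, dif_neg hx, homeomorphUnitSphereProd_apply_snd_coe]
          rw [mul_comm]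
          congr 2
          exact Subtype.ext (homeomorphUnitSphereProd_apply_fst_coe V x).symm
      _ = ∫ z, q z.1 * (radialBump ((z.2 : ℝ) ^ 2) : ℂ) ∂(volume : Measure V).toSphere.prod
            (Measure.volumeIoiPow (Module.finrank ℝ V - 1)) :=
          (volume : Measure V).measurePreserving_homeomorphUnitSphereProd.integral_comp
            (Homeomorph.measurableEmbedding _) (fun z : sphere (0 : V) 1 × Set.Ioi (0 : ℝ) ↦
              q z.1 * (radialBump ((z.2 : ℝ) ^ 2) : ℂ))
      _ = _ := by
          rw [integral_prod_mul q fun r : Set.Ioi (0 : ℝ) ↦ (radialBump ((r : ℝ) ^ 2) : ℂ),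
            mul_comm]
  refine ⟨c, fun hc ↦ ?_, key⟩
  -- To see c ≠ 0, test with q = 1: the left side is the integral of a nonnegative continuous bump,
  -- positive where ‖x‖² = 2.
  have h1 := key fun _ ↦ 1
  rw [hc, zero_mul] at h1
  have hne : radialBump (‖(EuclideanSpace.single 0 (Real.sqrt 2) : V)‖ ^ 2) ≠ 0 := by
    have : ‖(EuclideanSpace.single 0 (Real.sqrt 2) : V)‖ ^ 2 = 2 := by simp
    rw [this]
    exact (radialBump.pos_of_mem_ball (mem_ball_self radialBump.rOut_pos)).ne'
  have hpos : 0 < ∫ x : V, radialBump (‖x‖ ^ 2) :=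
    continuous_radialBump.integral_pos_of_hasCompactSupport_nonneg_nonzero
      hasCompactSupport_radialBump (fun x ↦ radialBump.nonneg) hne
  have h2 : ∫ x : V, (radialBump (‖x‖ ^ 2) : ℂ) * radialExtension (fun _ : unitSphere n ↦ 1) x =
      ∫ x : V, (radialBump (‖x‖ ^ 2) : ℂ) := by
    refine integral_congr_ae (.of_forall fun x ↦ ?_)
    by_cases hx : x = 0
    · simp [hx, radialBump_eq_zero_of_le]
    · simp [radialExtension, hx]
  rw [h2, integral_complex_ofReal] at h1
  exact hpos.ne' (by exact_mod_cast h1)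

theorem integral_fderiv_eq_zero_of_hasCompactSupport {m : ℕ} {W : EuclideanSpace ℝ (Fin m) → ℂ}
    (hW : ContDiff ℝ 1 W) (hc : HasCompactSupport W) (v : EuclideanSpace ℝ (Fin m)) :
    Integrable (fun x ↦ fderiv ℝ W x v) ∧ ∫ x, fderiv ℝ W x v = 0 := by
  have hcont : Continuous fun x ↦ fderiv ℝ W x v :=
    (hW.continuous_fderiv one_ne_zero).clm_apply continuous_const
  have hi : Integrable (fun x ↦ fderiv ℝ W x v) :=
    hcont.integrable_of_hasCompactSupport (hc.fderiv_apply ℝ v)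
  refine ⟨hi, ?_⟩
  have h := integral_mul_fderiv_eq_neg_fderiv_mul_of_integrable
    (μ := (volume : Measure (EuclideanSpace ℝ (Fin m))))
    (f := fun _ ↦ (1 : ℂ)) (g := W) (v := v) (by simp) (by simpa using hi)
    (by simpa using hW.continuous.integrable_of_hasCompactSupport hc)
    (fun _ _ ↦ differentiableAt_const _) (fun x _ ↦ hW.differentiable one_ne_zero x)
  simpa using h

theorem laplacian_eq_sum_single {m : ℕ} (G : EuclideanSpace ℝ (Fin m) → ℂ)
    (x : EuclideanSpace ℝ (Fin m)) :
    Δ G x = ∑ i, fderiv ℝ (fderiv ℝ G) x (EuclideanSpace.single i 1)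
      (EuclideanSpace.single i 1) := by
  rw [laplacian_eq_iteratedFDeriv_orthonormalBasis G (EuclideanSpace.basisFun (Fin m) ℝ)]
  simp [iteratedFDeriv_two_apply]

/-- The radially cut off field `φ (h ∇f - f ∇h)`, where `φ` is radial: its components. -/
def greenField (f h : unitSphere n → ℂ) (i : Fin (n + 1)) (x : EuclideanSpace ℝ (Fin (n + 1))) :
    ℂ :=
  ((radialBump (‖x‖ ^ 2) * ‖x‖ ^ 2 : ℝ) : ℂ) *
    (radialExtension h x * fderiv ℝ (radialExtension f) x (EuclideanSpace.single i 1) -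
      radialExtension f x * fderiv ℝ (radialExtension h) x (EuclideanSpace.single i 1))

theorem greenField_eventuallyEq_zero (f h : unitSphere n → ℂ) (i : Fin (n + 1)) :
    greenField f h i =ᶠ[nhds 0] fun _ ↦ 0 := by
  filter_upwards [ball_mem_nhds (0 : EuclideanSpace ℝ (Fin (n + 1))) one_pos] with x hx
  rw [mem_ball_zero_iff] at hx
  rw [greenField, radialBump_eq_zero_of_le (by nlinarith [norm_nonneg x])]
  simp

theorem hasCompactSupport_greenField (f h : unitSphere n → ℂ) (i : Fin (n + 1)) :
    HasCompactSupport (greenField f h i) :=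
  HasCompactSupport.intro (isCompact_closedBall 0 2) fun x hx ↦ by
    rw [mem_closedBall_zero_iff, not_le] at hx
    rw [greenField, radialBump_eq_zero_of_ge (by nlinarith)]
    simp

theorem contDiffAt_fderiv_apply {m : ℕ} {G : EuclideanSpace ℝ (Fin m) → ℂ}
    {x : EuclideanSpace ℝ (Fin m)} (hG : ContDiffAt ℝ 2 G x) (v : EuclideanSpace ℝ (Fin m)) :
    ContDiffAt ℝ 1 (fun y ↦ fderiv ℝ G y v) x :=
  (hG.fderiv_right (m := 1) le_rfl).clm_apply contDiffAt_const

theorem contDiff_radialFactor {m : ℕ} : ContDiff ℝ 1 fun x : EuclideanSpace ℝ (Fin m) ↦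
    ((radialBump (‖x‖ ^ 2) * ‖x‖ ^ 2 : ℝ) : ℂ) :=
  Complex.ofRealCLM.contDiff.comp
    ((radialBump.contDiff.comp (contDiff_norm_sq ℝ)).mul (contDiff_norm_sq ℝ))

theorem contDiff_greenField {f h : unitSphere n → ℂ} (hf : ContMDiff (𝓡 n) 𝓘(ℝ, ℂ) 2 f)
    (hh : ContMDiff (𝓡 n) 𝓘(ℝ, ℂ) 2 h) (i : Fin (n + 1)) : ContDiff ℝ 1 (greenField f h i) := by
  rw [contDiff_iff_contDiffAt]
  intro x
  by_cases hx : x = 0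
  · rw [hx]
    exact contDiffAt_const.congr_of_eventuallyEq (greenField_eventuallyEq_zero f h i)
  · have hF := contDiffAt_radialExtension hf hx
    have hH := contDiffAt_radialExtension hh hx
    exact contDiff_radialFactor.contDiffAt.mul
      (((hH.of_le one_le_two).mul (contDiffAt_fderiv_apply hF _)).sub
        ((hF.of_le one_le_two).mul (contDiffAt_fderiv_apply hH _)))

/-- The gradient of a radial function is a multiple of x. The value of a is irrelevant: it only
multiplies radial derivatives of functions of degree 0, which vanish. -/
theorem fderiv_radialFactor {m : ℕ} (x : EuclideanSpace ℝ (Fin m)) : ∃ a : ℂ,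
    ∀ v, fderiv ℝ (fun x : EuclideanSpace ℝ (Fin m) ↦
      ((radialBump (‖x‖ ^ 2) * ‖x‖ ^ 2 : ℝ) : ℂ)) x v = a * (inner ℝ x v : ℝ) := by
  have hd : DifferentiableAt ℝ (fun t : ℝ ↦ ((radialBump t * t : ℝ) : ℂ)) (‖x‖ ^ 2) :=
    (Complex.ofRealCLM.contDiff.comp ((radialBump.contDiff (n := 1)).mul contDiff_id)).differentiable
      one_ne_zero _
  have h := (hd.hasFDerivAt.comp x (hasStrictFDerivAt_norm_sq x).hasFDerivAt).fderiv
  refine ⟨2 * deriv (fun t : ℝ ↦ ((radialBump t * t : ℝ) : ℂ)) (‖x‖ ^ 2), fun v ↦ ?_⟩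
  change fderiv ℝ ((fun t : ℝ ↦ ((radialBump t * t : ℝ) : ℂ)) ∘ fun x ↦ ‖x‖ ^ 2) x v = _
  rw [h, ContinuousLinearMap.comp_apply, ← fderiv_apply_one_eq_deriv]
  have : ((2 : ℕ) • innerSL ℝ x) v = (2 * inner ℝ x v) • (1 : ℝ) := by simp
  rw [this, map_smul, Complex.real_smul]
  push_cast
  ring

theorem sum_apply_single_mul {m : ℕ} (L : EuclideanSpace ℝ (Fin m) →L[ℝ] ℂ)
    (x : EuclideanSpace ℝ (Fin m)) :
    ∑ i, (inner ℝ x (EuclideanSpace.single i (1 : ℝ)) : ℝ) * L (EuclideanSpace.single i 1) =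
      L x := by
  conv_rhs => rw [← (EuclideanSpace.basisFun (Fin m) ℝ).sum_repr x]
  simp [map_sum, EuclideanSpace.inner_single_right]

/-- In the divergence the products of first derivatives cancel by antisymmetry. The cutoff
contributes only radial derivatives of the two extensions, which are 0 by Euler's identity. -/
theorem sum_fderiv_greenField {f h : unitSphere n → ℂ} (hf : ContMDiff (𝓡 n) 𝓘(ℝ, ℂ) 2 f)
    (hh : ContMDiff (𝓡 n) 𝓘(ℝ, ℂ) 2 h) (x : EuclideanSpace ℝ (Fin (n + 1))) :
    ∑ i, fderiv ℝ (greenField f h i) x (EuclideanSpace.single i 1) =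
      (radialBump (‖x‖ ^ 2) : ℂ) * radialExtension (fun y ↦
        laplaceBeltrami (roundMetric n) f y * h y - f y * laplaceBeltrami (roundMetric n) h y) x :=
    by
  by_cases hx : x = 0
  · have h1 (i) : fderiv ℝ (greenField f h i) x = 0 := by
      rw [hx, (greenField_eventuallyEq_zero f h i).fderiv_eq, fderiv_fun_const]
      rfl
    rw [Finset.sum_eq_zero fun i _ ↦ by rw [h1]; rfl]
    simp [hx, radialBump_eq_zero_of_le]
  have hF := contDiffAt_radialExtension hf hx
  have hH := contDiffAt_radialExtension hh hx
  obtain ⟨a, ha⟩ := fderiv_radialFactor x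
  have hF0 := (isPosHomogeneous_radialExtension f).fderiv_self (hF.differentiableAt two_ne_zero)
  have hH0 := (isPosHomogeneous_radialExtension h).fderiv_self (hH.differentiableAt two_ne_zero)
  have hR : radialExtension (fun y ↦
      laplaceBeltrami (roundMetric n) f y * h y - f y * laplaceBeltrami (roundMetric n) h y) x =
      radialExtension (laplaceBeltrami (roundMetric n) f) x * radialExtension h x -
      radialExtension f x * radialExtension (laplaceBeltrami (roundMetric n) h) x := by
    simp [radialExtension, hx]
  -- The weight ‖x‖² in the field compensates the degree −2 of the flat Laplacians.
  rw [hR, ← laplacian_radialExtension hf hx, ← laplacian_radialExtension hh hx,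
    laplacian_eq_sum_single, laplacian_eq_sum_single]
  unfold greenField
  generalize radialExtension f = F at *
  generalize radialExtension h = H at *
  have hd (i : Fin (n + 1)) := ((contDiff_radialFactor.differentiable one_ne_zero x).hasFDerivAt.fun_mul
    (((hH.differentiableAt two_ne_zero).hasFDerivAt.fun_mul ((contDiffAt_fderiv_apply hF
      (EuclideanSpace.single i 1)).differentiableAt one_ne_zero).hasFDerivAt).fun_sub
     ((hF.differentiableAt two_ne_zero).hasFDerivAt.fun_mul ((contDiffAt_fderiv_apply hH
      (EuclideanSpace.single i 1)).differentiableAt one_ne_zero).hasFDerivAt))).fderiv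
  have h2 {G : EuclideanSpace ℝ (Fin (n + 1)) → ℂ} (hG : ContDiffAt ℝ 2 G x) (i : Fin (n + 1)) :
      fderiv ℝ (fun y ↦ fderiv ℝ G y (EuclideanSpace.single i 1)) x (EuclideanSpace.single i 1) =
      fderiv ℝ (fderiv ℝ G) x (EuclideanSpace.single i 1) (EuclideanSpace.single i 1) := by
    have := (((hG.fderiv_right (m := 1) le_rfl).differentiableAt one_ne_zero).hasFDerivAt.clm_apply
      (hasFDerivAt_const (EuclideanSpace.single i (1 : ℝ)) x)).fderiv
    rw [this]
    simp
  have e (i : Fin (n + 1)) := congrArg (· (EuclideanSpace.single i (1 : ℝ))) (hd i)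
  have hterm (i : Fin (n + 1)) : fderiv ℝ (fun x ↦ ((radialBump (‖x‖ ^ 2) * ‖x‖ ^ 2 : ℝ) : ℂ) *
      (H x * fderiv ℝ F x (EuclideanSpace.single i 1) -
        F x * fderiv ℝ H x (EuclideanSpace.single i 1))) x (EuclideanSpace.single i 1) =
      ((radialBump (‖x‖ ^ 2) * ‖x‖ ^ 2 : ℝ) : ℂ) * H x *
        fderiv ℝ (fderiv ℝ F) x (EuclideanSpace.single i 1) (EuclideanSpace.single i 1) -
      ((radialBump (‖x‖ ^ 2) * ‖x‖ ^ 2 : ℝ) : ℂ) * F x *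
        fderiv ℝ (fderiv ℝ H) x (EuclideanSpace.single i 1) (EuclideanSpace.single i 1) +
      (a * H x * ((inner ℝ x (EuclideanSpace.single i (1 : ℝ)) : ℝ) *
          fderiv ℝ F x (EuclideanSpace.single i 1)) -
        a * F x * ((inner ℝ x (EuclideanSpace.single i (1 : ℝ)) : ℝ) *
          fderiv ℝ H x (EuclideanSpace.single i 1))) := by
    refine (e i).trans ?_
    simp only [_root_.add_apply, _root_.sub_apply,
      _root_.smul_apply, h2 hF, h2 hH, ha, smul_eq_mul]
    ring
  refine (Finset.sum_congr rfl fun i _ ↦ hterm i).trans ?_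
  simp only [Finset.sum_add_distrib, Finset.sum_sub_distrib, ← Finset.mul_sum,
    sum_apply_single_mul, hF0, hH0]
  push_cast
  ring

/-- Green's second identity on the sphere. -/
theorem integral_laplaceBeltrami_mul_sub {f h : unitSphere n → ℂ}
    (hf : ContMDiff (𝓡 n) 𝓘(ℝ, ℂ) 2 f) (hh : ContMDiff (𝓡 n) 𝓘(ℝ, ℂ) 2 h) :
    ∫ x, (laplaceBeltrami (roundMetric n) f x * h x - f x * laplaceBeltrami (roundMetric n) h x)
      ∂(volume : Measure (EuclideanSpace ℝ (Fin (n + 1)))).toSphere = 0 := by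
  obtain ⟨c, hc, hpolar⟩ := integral_radialBump_mul_radialExtension n
  -- In polar coordinates the integral of the divergence, which is 0, is c times the integral over
  -- the sphere.
  refine (mul_eq_zero.1 ((hpolar _).symm.trans ?_)).resolve_left hc
  simp only [← sum_fderiv_greenField hf hh]
  have key (i) := integral_fderiv_eq_zero_of_hasCompactSupport (contDiff_greenField hf hh i)
    (hasCompactSupport_greenField f h i) (EuclideanSpace.single i 1)
  rw [integral_finsetSum _ fun i _ ↦ (key i).1]
  exact Finset.sum_eq_zero fun i _ ↦ (key i).2

end Green

/-! ### Algebra of homogeneous polynomials and of |x|² -/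

section Polynomials

open MvPolynomial

variable {m : ℕ}

theorem polyFun_add (P Q : MvPolynomial (Fin m) ℂ) (x : EuclideanSpace ℝ (Fin m)) :
    polyFun (P + Q) x = polyFun P x + polyFun Q x := map_add _ _ _

theorem polyFun_mul (P Q : MvPolynomial (Fin m) ℂ) (x : EuclideanSpace ℝ (Fin m)) :
    polyFun (P * Q) x = polyFun P x * polyFun Q x := map_mul _ _ _

theorem polyFun_smul (c : ℂ) (P : MvPolynomial (Fin m) ℂ) (x : EuclideanSpace ℝ (Fin m)) :
    polyFun (c • P) x = c * polyFun P x := smul_eval _ _ _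

theorem polyFun_sum {ι : Type*} (s : Finset ι) (P : ι → MvPolynomial (Fin m) ℂ)
    (x : EuclideanSpace ℝ (Fin m)) : polyFun (∑ i ∈ s, P i) x = ∑ i ∈ s, polyFun (P i) x :=
  map_sum _ _ _

theorem contDiff_polyFun {k : ℕ∞ω} (P : MvPolynomial (Fin m) ℂ) : ContDiff ℝ k (polyFun P) := by
  induction P using MvPolynomial.induction_on with
  | C a =>
    rw [show polyFun (C a : MvPolynomial (Fin m) ℂ) = fun _ ↦ a from funext fun x ↦ eval_C a]
    exact contDiff_const
  | add P Q hP hQ =>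
    rw [funext (polyFun_add P Q)]
    exact hP.add hQ
  | mul_X P i hP =>
    rw [funext (polyFun_mul P (X i))]
    refine hP.mul ?_
    rw [show polyFun (X i : MvPolynomial (Fin m) ℂ) = fun x ↦ (x i : ℂ) from
      funext fun x ↦ eval_X i]
    exact Complex.ofRealCLM.contDiff.comp (EuclideanSpace.proj (𝕜 := ℝ) i).contDiff

theorem fderiv_polyFun_single (P : MvPolynomial (Fin m) ℂ) (x : EuclideanSpace ℝ (Fin m))
    (i : Fin m) : fderiv ℝ (polyFun P) x (EuclideanSpace.single i 1) = polyFun (pderiv i P) x := by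
  induction P using MvPolynomial.induction_on with
  | C a =>
    have : polyFun (C a : MvPolynomial (Fin m) ℂ) = fun _ ↦ a := funext fun x ↦ eval_C a
    rw [this, fderiv_fun_const, pderiv_C]
    simp [polyFun]
  | add P Q hP hQ =>
    rw [funext (polyFun_add P Q), fderiv_fun_add
      ((contDiff_polyFun (k := 1) P).differentiable one_ne_zero x)
      ((contDiff_polyFun (k := 1) Q).differentiable one_ne_zero x), map_add, polyFun_add, ← hP, ← hQ]
    rfl
  | mul_X P j hP =>
    have hX : polyFun (X j : MvPolynomial (Fin m) ℂ) =
        Complex.ofRealCLM.comp (EuclideanSpace.proj (𝕜 := ℝ) j) := funext fun x ↦ eval_X j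
    have hXd : fderiv ℝ (polyFun (X j : MvPolynomial (Fin m) ℂ)) x =
        Complex.ofRealCLM.comp (EuclideanSpace.proj (𝕜 := ℝ) j) := by
      rw [hX, ContinuousLinearMap.fderiv]
    rw [funext (polyFun_mul P (X j)), fderiv_fun_mul
      ((contDiff_polyFun (k := 1) P).differentiable one_ne_zero x)
      ((contDiff_polyFun (k := 1) _).differentiable one_ne_zero x), Derivation.leibniz, polyFun_add,
      smul_eq_mul, smul_eq_mul, polyFun_mul, polyFun_mul, ← hP, hXd, pderiv_X]
    by_cases h : j = i
    · subst h
      simp [polyFun]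
    · simp [polyFun, h]

/-- The Laplacian of a polynomial, as a polynomial. -/
def polyLaplacian : MvPolynomial (Fin m) ℂ →ₗ[ℂ] MvPolynomial (Fin m) ℂ :=
  ∑ i, (pderiv i).toLinearMap ∘ₗ (pderiv i).toLinearMap

theorem polyLaplacian_apply (P : MvPolynomial (Fin m) ℂ) :
    polyLaplacian P = ∑ i, pderiv i (pderiv i P) := by
  simp [polyLaplacian]

theorem laplacian_polyFun (P : MvPolynomial (Fin m) ℂ) (x : EuclideanSpace ℝ (Fin m)) :
    Δ (polyFun P) x = polyFun (polyLaplacian P) x := by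
  rw [laplacian_eq_sum_single, polyLaplacian_apply, polyFun_sum]
  refine Finset.sum_congr rfl fun i _ ↦ ?_
  have hd : DifferentiableAt ℝ (fderiv ℝ (polyFun P)) x :=
    ((contDiff_polyFun (k := 2) P).fderiv_right (m := 1) le_rfl).differentiable one_ne_zero x
  have h1 := (hd.hasFDerivAt.clm_apply
      (hasFDerivAt_const (EuclideanSpace.single i (1 : ℝ)) x)).fderiv
  rw [← fderiv_polyFun_single (pderiv i P), ← funext fun y ↦ fderiv_polyFun_single P y i, h1]
  simp

theorem isHomogeneous_polyLaplacian {P : MvPolynomial (Fin m) ℂ} {k : ℕ} (hP : P.IsHomogeneous k) :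
    (polyLaplacian P).IsHomogeneous (k - 1 - 1) := by
  rw [polyLaplacian_apply]
  exact IsHomogeneous.sum _ _ _ fun i _ ↦ hP.pderiv.pderiv

theorem polyLaplacian_eq_zero_of_le_one {P : MvPolynomial (Fin m) ℂ} {k : ℕ}
    (hP : P.IsHomogeneous k) (hk : k ≤ 1) : polyLaplacian P = 0 := by
  rw [polyLaplacian_apply]
  refine Finset.sum_eq_zero fun i _ ↦ ?_
  have h := hP.pderiv (i := i)
  rw [Nat.sub_eq_zero_of_le hk, ← totalDegree_zero_iff_isHomogeneous,
    totalDegree_eq_zero_iff_eq_C] at h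
  rw [h, pderiv_C]

theorem isPosHomogeneous_polyFun {P : MvPolynomial (Fin m) ℂ} {k : ℕ} (hP : P.IsHomogeneous k) :
    IsPosHomogeneous k (polyFun P) := by
  intro t x _
  simp only [polyFun, eval_eq', PiLp.smul_apply, smul_eq_mul, Complex.ofReal_mul, mul_pow,
    Finset.prod_mul_distrib, Finset.mul_sum]
  refine Finset.sum_congr rfl fun d hd ↦ ?_
  have hk : ∑ i, d i = k := by
    rw [hP.degree_eq_sum_deg_support hd]
    exact (Finset.sum_subset (Finset.subset_univ _) (by simp)).symm
  rw [Finset.prod_pow_eq_pow_sum, hk]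
  ring

/-- The squared norm, as a polynomial. -/
def polyNormSq (m : ℕ) : MvPolynomial (Fin m) ℂ := ∑ i, X i ^ 2

theorem polyFun_polyNormSq (x : EuclideanSpace ℝ (Fin m)) :
    polyFun (polyNormSq m) x = (‖x‖ ^ 2 : ℝ) := by
  rw [polyNormSq, polyFun_sum, EuclideanSpace.real_norm_sq_eq]
  push_cast
  refine Finset.sum_congr rfl fun i _ ↦ ?_
  simp [polyFun]

theorem isHomogeneous_polyNormSq : (polyNormSq m).IsHomogeneous 2 :=
  IsHomogeneous.sum _ _ _ fun i _ ↦ isHomogeneous_X_pow i 2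

/-- Multiplying by |x|² restores the degree of ΔP without changing its values on the sphere, so both
can be compared within one degree. -/
theorem isHomogeneous_polyNormSq_mul_polyLaplacian {P : MvPolynomial (Fin m) ℂ} {k : ℕ}
    (hP : P.IsHomogeneous k) : (polyNormSq m * polyLaplacian P).IsHomogeneous k := by
  by_cases hk : k ≤ 1
  · rw [polyLaplacian_eq_zero_of_le_one hP hk, mul_zero]
    exact isHomogeneous_zero _ _ _
  · convert isHomogeneous_polyNormSq.mul (isHomogeneous_polyLaplacian hP) using 1
    omega

/-- The polynomial with conjugate coefficients. -/
def polyConj (P : MvPolynomial (Fin m) ℂ) : MvPolynomial (Fin m) ℂ := map (starRingEnd ℂ) P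

theorem polyFun_polyConj (P : MvPolynomial (Fin m) ℂ) (x : EuclideanSpace ℝ (Fin m)) :
    polyFun (polyConj P) x = starRingEnd ℂ (polyFun P x) := by
  rw [polyConj, polyFun, polyFun, eval_map, eval₂_eq', eval_eq', map_sum]
  simp

/-- Homogeneity spreads the zeros from the sphere to all points with positive coordinates, a product
of infinite sets. Without it the claim fails, as |x|² − 1 shows. -/
theorem eq_zero_of_polyFun_coe_eq_zero {n k : ℕ} {P : MvPolynomial (Fin (n + 1)) ℂ}
    (hP : P.IsHomogeneous k) (h : ∀ x : unitSphere n, polyFun P x = 0) : P = 0 := by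
  refine funext_set (fun _ ↦ Complex.ofReal '' Set.Ioi 0)
    (fun _ ↦ (Set.Ioi_infinite 0).image Complex.ofReal_injective.injOn) fun z hz ↦ ?_
  have hz' (i) : ∃ t : ℝ, 0 < t ∧ (t : ℂ) = z i := hz i trivial
  choose t ht htz using hz'
  let x : EuclideanSpace ℝ (Fin (n + 1)) := WithLp.toLp 2 t
  have hx : x ≠ 0 := fun h0 ↦ (ht 0).ne' (congrFun (congrArg WithLp.ofLp h0) 0)
  have h1 := isPosHomogeneous_polyFun hP ‖x‖ (‖x‖⁻¹ • x) (norm_pos_iff.2 hx)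
  rw [smul_smul, mul_inv_cancel₀ (norm_ne_zero_iff.2 hx), one_smul,
    h ⟨‖x‖⁻¹ • x, by simp [norm_smul, hx]⟩, mul_zero] at h1
  rw [map_zero, ← h1, polyFun]
  exact congrArg (fun y ↦ eval y P) (_root_.funext fun i ↦ (htz i).symm)

open Polynomial in
/-- The polynomial `X² + q` is squarefree unless `q = 0`. -/
theorem X_sq_add_C_dvd_of_dvd_sq {R : Type*} [CommRing R] [IsDomain R] (h2 : (2 : R) ≠ 0) {q : R}
    (hq : q ≠ 0) {p : R[X]} (hp : (Polynomial.X ^ 2 + Polynomial.C q) ∣ p ^ 2) :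
    (Polynomial.X ^ 2 + Polynomial.C q) ∣ p := by
  set D : R[X] := Polynomial.X ^ 2 + Polynomial.C q
  have hD : D.Monic := monic_X_pow_add_C q two_ne_zero
  have hdeg : D.degree = 2 := degree_X_pow_add_C two_pos q
  have hs : (p %ₘ D).degree ≤ 1 := by
    have := degree_modByMonic_lt p hD
    rw [hdeg] at this
    exact Order.le_of_lt_succ this
  obtain ⟨b, a, hab⟩ : ∃ b a, p %ₘ D = Polynomial.C b * Polynomial.X + Polynomial.C a :=
    ⟨_, _, eq_X_add_C_of_degree_le_one hs⟩
  -- Modulo D one has X² = −q, so p² is congruent to (bX + a)² = 2abX + (a² − qb²). This has degree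
  -- below 2, hence is 0, and q ≠ 0 then forces a = b = 0.
  have hdvd : D ∣ Polynomial.C (2 * a * b) * Polynomial.X + Polynomial.C (a ^ 2 - q * b ^ 2) := by
    obtain ⟨u, hu⟩ : ∃ u, p = Polynomial.C b * Polynomial.X + Polynomial.C a + D * u :=
      ⟨p /ₘ D, by rw [← hab, modByMonic_add_div]⟩
    have h3 : Polynomial.C (2 * a * b) * Polynomial.X + Polynomial.C (a ^ 2 - q * b ^ 2) =
        p ^ 2 - D * (2 * (Polynomial.C b * Polynomial.X + Polynomial.C a) * u +
          D * u ^ 2 + Polynomial.C (b ^ 2)) := by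
      rw [hu]
      simp only [D, map_mul, map_sub, map_pow, map_ofNat]
      ring
    rw [h3]
    exact dvd_sub hp (dvd_mul_right _ _)
  have hzero := eq_zero_of_dvd_of_degree_lt hdvd (by rw [hdeg]; exact degree_linear_lt)
  have hb0 : 2 * a * b = 0 := by
    simpa only [Polynomial.coeff_add, Polynomial.coeff_C_mul, coeff_X_one, coeff_C_succ, mul_one, add_zero,
      Polynomial.coeff_zero] using congrArg (Polynomial.coeff · 1) hzero
  have ha0 : a ^ 2 - q * b ^ 2 = 0 := by
    simpa only [Polynomial.coeff_add, Polynomial.coeff_C_mul, Polynomial.coeff_X_zero, Polynomial.coeff_C_zero,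
      mul_zero, zero_add, Polynomial.coeff_zero] using congrArg (Polynomial.coeff · 0) hzero
  have hab0 : a = 0 ∧ b = 0 := by
    rcases mul_eq_zero.1 hb0 with h | h
    · have ha : a = 0 := (mul_eq_zero.1 h).resolve_left h2
      refine ⟨ha, ?_⟩
      simpa [ha, hq] using ha0
    · refine ⟨?_, h⟩
      simpa [h] using ha0
  rw [← modByMonic_eq_zero_iff_dvd hD, hab, hab0.1, hab0.2]
  simp

theorem polyNormSq_ne_zero (hm : 0 < m) : polyNormSq m ≠ 0 := by
  intro h
  have h1 := polyFun_polyNormSq (EuclideanSpace.single (⟨0, hm⟩ : Fin m) (1 : ℝ))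
  rw [h] at h1
  simp [polyFun] at h1

/-- As a polynomial in the first variable, |x|² is X² + q with q the sum of the other n squares,
nonzero because n > 0. Only squarefreeness is needed: for n = 1 the form factors over ℂ. -/
theorem polyNormSq_dvd_of_dvd_sq {n : ℕ} (hn : 0 < n) {P : MvPolynomial (Fin (n + 1)) ℂ}
    (h : polyNormSq (n + 1) ∣ P ^ 2) : polyNormSq (n + 1) ∣ P := by
  have hr : finSuccEquiv ℂ n (polyNormSq (n + 1)) =
      Polynomial.X ^ 2 + Polynomial.C (polyNormSq n) := by
    rw [polyNormSq, Fin.sum_univ_succ, map_add, map_pow, finSuccEquiv_X_zero, polyNormSq, map_sum,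
      map_sum]
    simp only [map_pow, finSuccEquiv_X_succ]
  rw [← map_dvd_iff (finSuccEquiv ℂ n), hr] at h ⊢
  rw [map_pow] at h
  exact X_sq_add_C_dvd_of_dvd_sq two_ne_zero (polyNormSq_ne_zero hn) h

end Polynomials

/-! ### Integration against polynomials and the spectral theorem -/

section Orthogonality

open MeasureTheory

variable {n : ℕ}

/-- The surface measure of the unit sphere. -/
abbrev surfaceMeasure (n : ℕ) : Measure (unitSphere n) :=
  (volume : Measure (EuclideanSpace ℝ (Fin (n + 1)))).toSphere

theorem integrable_surfaceMeasure {E : Type*} [NormedAddCommGroup E] {g : unitSphere n → E}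
    (hg : Continuous g) : Integrable g (surfaceMeasure n) :=
  hg.integrable_of_hasCompactSupport (HasCompactSupport.of_compactSpace g)

theorem continuous_polyFun_coe (P : MvPolynomial (Fin (n + 1)) ℂ) :
    Continuous fun x : unitSphere n ↦ polyFun P x :=
  (contDiff_polyFun (k := 0) P).continuous.comp continuous_subtype_val

theorem contMDiff_polyFun_coe {k : ℕ∞ω} (P : MvPolynomial (Fin (n + 1)) ℂ) :
    ContMDiff (𝓡 n) 𝓘(ℝ, ℂ) k fun x : unitSphere n ↦ polyFun P x :=
  have := Fact.mk (@finrank_euclideanSpace_fin ℝ _ (n + 1))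
  (contDiff_polyFun P).contMDiff.comp contMDiff_coe_sphere

theorem laplaceBeltrami_polyFun {P : MvPolynomial (Fin (n + 1)) ℂ} {k : ℕ}
    (hP : P.IsHomogeneous k) (x : unitSphere n) :
    laplaceBeltrami (roundMetric n) (fun x : unitSphere n ↦ polyFun P x) x =
      polyFun (polyLaplacian P) x + sphereEigenvalue n k * polyFun P x := by
  rw [laplaceBeltrami_of_isPosHomogeneous (contMDiff_polyFun_coe P) (fun _ ↦ rfl)
    (isPosHomogeneous_polyFun hP) x (contDiff_polyFun P).contDiffAt, laplacian_polyFun]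

theorem eq_zero_of_integral_mul_conj_eq_zero {g : unitSphere n → ℂ} (hg : Continuous g)
    (h : ∫ x, g x * starRingEnd ℂ (g x) ∂surfaceMeasure n = 0) : g = 0 := by
  by_contra hne
  obtain ⟨p, hp⟩ := Function.ne_iff.1 hne
  have h1 : ∫ x, g x * starRingEnd ℂ (g x) ∂surfaceMeasure n =
      ((∫ x, ‖g x‖ ^ 2 ∂surfaceMeasure n : ℝ) : ℂ) := by
    rw [← integral_complex_ofReal]
    simp only [Complex.mul_conj']
    push_cast
    rfl
  have h2 : 0 < ∫ x, ‖g x‖ ^ 2 ∂surfaceMeasure n :=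
    (hg.norm.pow 2).integral_pos_of_hasCompactSupport_nonneg_nonzero
      (HasCompactSupport.of_compactSpace _) (fun x ↦ by positivity)
      (x := p) (pow_ne_zero 2 (norm_ne_zero_iff.2 hp))
  rw [h1] at h
  exact h2.ne' (by exact_mod_cast h)

/-- The algebra homomorphism sending a polynomial to its restriction to the sphere. -/
def polyRestrict (n : ℕ) : MvPolynomial (Fin (n + 1)) ℂ →ₐ[ℂ] C(unitSphere n, ℂ) :=
  MvPolynomial.aeval fun i ↦
    ⟨fun x ↦ ((x : EuclideanSpace ℝ (Fin (n + 1))) i : ℂ), by fun_prop⟩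

theorem polyRestrict_apply (P : MvPolynomial (Fin (n + 1)) ℂ) (x : unitSphere n) :
    polyRestrict n P x = polyFun P x := by
  induction P using MvPolynomial.induction_on with
  | C a => simp [polyRestrict, polyFun]
  | add P Q hP hQ => rw [map_add, ContinuousMap.add_apply, hP, hQ, polyFun_add]
  | mul_X P i hP =>
    rw [map_mul, ContinuousMap.mul_apply, hP, polyFun_mul]
    simp [polyRestrict, polyFun]

/-- The star subalgebra of restrictions of polynomials to the sphere. -/
def polyStarSubalgebra (n : ℕ) : StarSubalgebra ℂ C(unitSphere n, ℂ) where
  __ := (polyRestrict n).range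
  star_mem' := by
    rintro _ ⟨P, rfl⟩
    refine ⟨polyConj P, ?_⟩
    ext x
    change polyRestrict n (polyConj P) x = starRingEnd ℂ (polyRestrict n P x)
    rw [polyRestrict_apply, polyRestrict_apply, polyFun_polyConj]

theorem polyStarSubalgebra_topologicalClosure (n : ℕ) :
    (polyStarSubalgebra n).topologicalClosure = ⊤ := by
  refine ContinuousMap.starSubalgebra_topologicalClosure_eq_top_of_separatesPoints _ ?_
  intro x y hxy
  have : ∃ i, (x : EuclideanSpace ℝ (Fin (n + 1))) i ≠ (y : EuclideanSpace ℝ (Fin (n + 1))) i := by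
    by_contra! h
    exact hxy (Subtype.ext (PiLp.ext h))
  obtain ⟨i, hi⟩ := this
  refine ⟨_, ⟨polyRestrict n (MvPolynomial.X i), ⟨MvPolynomial.X i, rfl⟩, rfl⟩, ?_⟩
  simpa [polyRestrict_apply, polyFun] using hi

theorem continuous_integral_mul {g : unitSphere n → ℂ} (hg : Continuous g) :
    Continuous fun u : C(unitSphere n, ℂ) ↦ ∫ x, g x * u x ∂surfaceMeasure n := by
  have h1 : Continuous fun u : C(unitSphere n, ℂ) ↦ ∫ x, u x ∂surfaceMeasure n := by
    have := continuous_integral.comp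
      (ContinuousMap.toLp (E := ℂ) 1 (surfaceMeasure n) ℂ).continuous
    refine this.congr fun u ↦ integral_congr_ae (ContinuousMap.coeFn_toLp _ _)
  exact h1.comp (continuous_const.mul continuous_id : Continuous fun u : C(unitSphere n, ℂ) ↦
    (⟨g, hg⟩ : C(unitSphere n, ℂ)) * u)

theorem integral_mul_polyFun_sum {g : unitSphere n → ℂ} (hg : Continuous g) {ι : Type*}
    (s : Finset ι) (P : ι → MvPolynomial (Fin (n + 1)) ℂ) :
    ∫ x, g x * polyFun (∑ i ∈ s, P i) x ∂surfaceMeasure n =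
      ∑ i ∈ s, ∫ x, g x * polyFun (P i) x ∂surfaceMeasure n := by
  simp only [polyFun_sum, Finset.mul_sum]
  exact integral_finsetSum _ fun i _ ↦
    integrable_surfaceMeasure (hg.mul (continuous_polyFun_coe (P i)))

/-- A continuous function which is orthogonal to all polynomials vanishes. -/
theorem eq_zero_of_integral_mul_polyFun_eq_zero {g : unitSphere n → ℂ} (hg : Continuous g)
    (h : ∀ (k : ℕ) (P : MvPolynomial (Fin (n + 1)) ℂ), P.IsHomogeneous k →
      ∫ x, g x * polyFun P x ∂surfaceMeasure n = 0) : g = 0 := by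
  have h1 (P : MvPolynomial (Fin (n + 1)) ℂ) : ∫ x, g x * polyFun P x ∂surfaceMeasure n = 0 := by
    rw [← P.sum_homogeneousComponent, integral_mul_polyFun_sum hg]
    exact Finset.sum_eq_zero fun i _ ↦ h i _ (MvPolynomial.homogeneousComponent_isHomogeneous i P)
  have hclosed : IsClosed {u : C(unitSphere n, ℂ) | ∫ x, g x * u x ∂surfaceMeasure n = 0} :=
    isClosed_eq (continuous_integral_mul hg) continuous_const
  have hsub : ((polyStarSubalgebra n : Set C(unitSphere n, ℂ))) ⊆
      {u : C(unitSphere n, ℂ) | ∫ x, g x * u x ∂surfaceMeasure n = 0} := by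
    rintro _ ⟨P, rfl⟩
    refine Eq.trans ?_ (h1 P)
    exact integral_congr_ae (.of_forall fun x ↦ congrArg (g x * ·) (polyRestrict_apply P x))
  -- By Stone–Weierstrass the conjugate of g is a uniform limit of polynomials, so g is orthogonal
  -- to it and ∫|g|² = 0.
  let u : C(unitSphere n, ℂ) := ⟨fun x ↦ starRingEnd ℂ (g x), Complex.continuous_conj.comp hg⟩
  have hu : u ∈ (polyStarSubalgebra n).topologicalClosure := by
    rw [polyStarSubalgebra_topologicalClosure]
    trivial
  rw [← SetLike.mem_coe, StarSubalgebra.topologicalClosure_coe] at hu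
  exact eq_zero_of_integral_mul_conj_eq_zero hg (closure_minimal hsub hclosed hu)

/-- `g` satisfies `Δ g = l g` in the weak sense, tested against homogeneous polynomials. -/
def IsWeakEigenfunction (l : ℂ) (g : unitSphere n → ℂ) : Prop :=
  ∀ (k : ℕ) (P : MvPolynomial (Fin (n + 1)) ℂ), P.IsHomogeneous k →
    (l - sphereEigenvalue n k) * ∫ x, g x * polyFun P x ∂surfaceMeasure n =
      ∫ x, g x * polyFun (polyLaplacian P) x ∂surfaceMeasure n

/-- Green's identity moves the operator onto P, where it is ΔP + λ_k P. -/
theorem isWeakEigenfunction_of_laplaceBeltrami {f : unitSphere n → ℂ} {l : ℂ}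
    (hf : ContMDiff (𝓡 n) 𝓘(ℝ, ℂ) 2 f) (hl : ∀ x, laplaceBeltrami (roundMetric n) f x = l * f x) :
    IsWeakEigenfunction l f := by
  intro k P hP
  have h := integral_laplaceBeltrami_mul_sub hf (contMDiff_polyFun_coe P)
  have e (x : unitSphere n) : laplaceBeltrami (roundMetric n) f x * polyFun P x -
      f x * laplaceBeltrami (roundMetric n) (fun x : unitSphere n ↦ polyFun P x) x =
      (l - sphereEigenvalue n k) * (f x * polyFun P x) - f x * polyFun (polyLaplacian P) x := by
    rw [hl, laplaceBeltrami_polyFun hP]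
    ring
  simp only [e] at h
  have hi (Q : MvPolynomial (Fin (n + 1)) ℂ) :
      Integrable (fun x : unitSphere n ↦ f x * polyFun Q x) (surfaceMeasure n) :=
    integrable_surfaceMeasure (hf.continuous.mul (continuous_polyFun_coe Q))
  rw [integral_sub ((hi P).const_mul _) (hi _), integral_const_mul, sub_eq_zero] at h
  exact h

/-- A weak eigenfunction with eigenvalue `l` is orthogonal to the polynomials of degree at most `K`
if it is so to those of the degree `k ≤ K` with eigenvalue `l`. -/
theorem IsWeakEigenfunction.integral_mul_polyFun_eq_zero {l : ℂ} {g : unitSphere n → ℂ}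
    (hg : IsWeakEigenfunction l g) (K : ℕ)
    (h : ∀ k ≤ K, l = sphereEigenvalue n k → ∀ P : MvPolynomial (Fin (n + 1)) ℂ,
      P.IsHomogeneous k → ∫ x, g x * polyFun P x ∂surfaceMeasure n = 0) :
    ∀ k ≤ K, ∀ P : MvPolynomial (Fin (n + 1)) ℂ, P.IsHomogeneous k →
      ∫ x, g x * polyFun P x ∂surfaceMeasure n = 0 := by
  intro k
  induction k using Nat.strong_induction_on with
  | _ k ih =>
    intro hk P hP
    by_cases hl : l = sphereEigenvalue n k
    · exact h k hk hl P hP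
    -- When l ≠ λ_k, the integral against P is a multiple of the integral against ΔP, of degree k −
    -- 2.
    refine (mul_eq_zero.1 ((hg k P hP).trans ?_)).resolve_left (sub_ne_zero.2 hl)
    by_cases hk1 : k ≤ 1
    · rw [polyLaplacian_eq_zero_of_le_one hP hk1]
      simp [polyFun]
    · exact ih (k - 1 - 1) (by omega) (by omega) _ (isHomogeneous_polyLaplacian hP)

/-- For n > 0, k(k+n−1) is strictly increasing in k; for n = 0 the degrees 0 and 1 would share the
eigenvalue 0. -/
theorem sphereEigenvalue_injective (hn : 0 < n) : Function.Injective (sphereEigenvalue n) := by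
  intro j k h
  rw [sphereEigenvalue, sphereEigenvalue, neg_inj] at h
  obtain ⟨m, rfl⟩ : ∃ m, n = m + 1 := ⟨n - 1, by omega⟩
  have h' : j * (j + m) = k * (k + m) := by
    have : ((j * (j + m) : ℕ) : ℂ) = (k * (k + m) : ℕ) := by
      push_cast at h ⊢
      linear_combination h
    exact_mod_cast this
  have hmono : StrictMono fun j : ℕ ↦ j * (j + m) := strictMono_nat_of_lt_succ fun j ↦ by
    nlinarith
  exact hmono.injective h'

/-- The bilinear form `∫ P Q` on homogeneous polynomials of degree `d`. -/
def sphereForm (n d : ℕ) : MvPolynomial.homogeneousSubmodule (Fin (n + 1)) ℂ d →ₗ[ℂ]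
    MvPolynomial.homogeneousSubmodule (Fin (n + 1)) ℂ d →ₗ[ℂ] ℂ :=
  LinearMap.mk₂ ℂ (fun P Q ↦ ∫ x : unitSphere n, polyFun P.1 x * polyFun Q.1 x ∂surfaceMeasure n)
    (fun P P' Q ↦ by
      simp only [Submodule.coe_add, polyFun_add, add_mul]
      exact integral_add (integrable_surfaceMeasure ((continuous_polyFun_coe _).mul
        (continuous_polyFun_coe _))) (integrable_surfaceMeasure ((continuous_polyFun_coe _).mul
        (continuous_polyFun_coe _))))
    (fun c P Q ↦ by
      simp only [Submodule.coe_smul, polyFun_smul, mul_assoc]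
      exact integral_const_mul _ _)
    (fun P Q Q' ↦ by
      simp only [Submodule.coe_add, polyFun_add, mul_add]
      exact integral_add (integrable_surfaceMeasure ((continuous_polyFun_coe _).mul
        (continuous_polyFun_coe _))) (integrable_surfaceMeasure ((continuous_polyFun_coe _).mul
        (continuous_polyFun_coe _))))
    (fun c P Q ↦ by
      simp only [Submodule.coe_smul, polyFun_smul, mul_left_comm _ c]
      exact integral_const_mul _ _)

theorem eq_zero_of_forall_integral_eq_zero {d : ℕ} {P : MvPolynomial (Fin (n + 1)) ℂ}
    (hP : P.IsHomogeneous d)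
    (h : ∀ Q : MvPolynomial (Fin (n + 1)) ℂ, Q.IsHomogeneous d →
      ∫ x : unitSphere n, polyFun P x * polyFun Q x ∂surfaceMeasure n = 0) : P = 0 := by
  have h1 := h (polyConj P) (hP.map _)
  simp only [polyFun_polyConj] at h1
  exact eq_zero_of_polyFun_coe_eq_zero hP
    (congrFun (eq_zero_of_integral_mul_conj_eq_zero (continuous_polyFun_coe P) h1))

/-- Projection of a continuous function to the homogeneous polynomials of degree `d`. -/
theorem exists_isHomogeneous_integral_eq (d : ℕ) {f : unitSphere n → ℂ} (hf : Continuous f) :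
    ∃ H : MvPolynomial (Fin (n + 1)) ℂ, H.IsHomogeneous d ∧
      ∀ Q : MvPolynomial (Fin (n + 1)) ℂ, Q.IsHomogeneous d →
        ∫ x : unitSphere n, polyFun H x * polyFun Q x ∂surfaceMeasure n =
          ∫ x, f x * polyFun Q x ∂surfaceMeasure n := by
  have hfin : Module.Finite ℂ (MvPolynomial.homogeneousSubmodule (Fin (n + 1)) ℂ d) :=
    Module.Finite.iff_fg.2 (MvPolynomial.homogeneousSubmodule_fg _ _ d)
  have hinj : Function.Injective (sphereForm n d) := by
    rw [← LinearMap.ker_eq_bot, LinearMap.ker_eq_bot']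
    intro P hP
    exact Subtype.ext (eq_zero_of_forall_integral_eq_zero P.2
      fun Q hQ ↦ LinearMap.congr_fun hP ⟨Q, hQ⟩)
  -- The form is nondegenerate on a finite-dimensional space, so every functional, in particular Q ↦
  -- ∫ f Q, is represented by some H.
  have hsurj := (LinearMap.injective_iff_surjective_of_finrank_eq_finrank
    (Subspace.dual_finrank_eq (K := ℂ)
      (V := MvPolynomial.homogeneousSubmodule (Fin (n + 1)) ℂ d)).symm).1 hinj
  let L : Module.Dual ℂ (MvPolynomial.homogeneousSubmodule (Fin (n + 1)) ℂ d) :=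
    { toFun := fun Q ↦ ∫ x, f x * polyFun Q.1 x ∂surfaceMeasure n
      map_add' := fun Q Q' ↦ by
        simp only [Submodule.coe_add, polyFun_add, mul_add]
        exact integral_add (integrable_surfaceMeasure (hf.mul (continuous_polyFun_coe _)))
          (integrable_surfaceMeasure (hf.mul (continuous_polyFun_coe _)))
      map_smul' := fun c Q ↦ by
        simp only [Submodule.coe_smul, polyFun_smul, mul_left_comm _ c]
        exact integral_const_mul _ _ }
  obtain ⟨H, hH⟩ := hsurj L
  exact ⟨H.1, H.2, fun Q hQ ↦ LinearMap.congr_fun hH ⟨Q, hQ⟩⟩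

/-- The spectral theorem for the sphere: the eigenfunctions of the Laplace–Beltrami operator are
the restrictions of harmonic homogeneous polynomials. -/
theorem exists_harmonic_polynomial (hn : 0 < n) {f : unitSphere n → ℂ} {l : ℂ}
    (hf : ContMDiff (𝓡 n) 𝓘(ℝ, ℂ) 2 f) (hl : ∀ x, laplaceBeltrami (roundMetric n) f x = l * f x)
    (hf0 : f ≠ 0) :
    ∃ (d : ℕ) (H : MvPolynomial (Fin (n + 1)) ℂ), l = sphereEigenvalue n d ∧ H.IsHomogeneous d ∧
      polyLaplacian H = 0 ∧ ∀ x : unitSphere n, f x = polyFun H x := by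
  have hw := isWeakEigenfunction_of_laplaceBeltrami hf hl
  -- If l were no λ_k, the recursion would kill all integrals of f against polynomials.
  obtain ⟨d, rfl⟩ : ∃ d, l = sphereEigenvalue n d := by
    by_contra! hne
    exact hf0 (eq_zero_of_integral_mul_polyFun_eq_zero hf.continuous fun k ↦
      hw.integral_mul_polyFun_eq_zero k (fun j _ hj ↦ absurd hj (hne j)) k le_rfl)
  obtain ⟨H, hH, hHf⟩ := exists_isHomogeneous_integral_eq d hf.continuous
  have hharm : polyLaplacian H = 0 := by
    -- For Q of degree d, ∫ (ΔH) Q = ∫ H ΔQ = ∫ f ΔQ = (l − λ_d) ∫ f Q = 0. The middle equality uses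
    -- the choice of H on |x|²ΔQ, again of degree d.
    have h0 : polyNormSq (n + 1) * polyLaplacian H = 0 := by
      refine eq_zero_of_forall_integral_eq_zero (n := n)
        (isHomogeneous_polyNormSq_mul_polyLaplacian hH) fun Q hQ ↦ ?_
      have hr (x : unitSphere n) : polyFun (polyNormSq (n + 1)) x = 1 := by
        rw [polyFun_polyNormSq, norm_coe_unitSphere]
        norm_num
      have h1 := hHf _ (isHomogeneous_polyNormSq_mul_polyLaplacian hQ)
      simp only [polyFun_mul, hr, one_mul] at h1 ⊢
      have h2 := hw d Q hQ
      rw [sub_self, zero_mul] at h2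
      have h3 := integral_laplaceBeltrami_mul_sub (contMDiff_polyFun_coe H)
        (contMDiff_polyFun_coe (n := n) Q)
      have e (x : unitSphere n) :
          laplaceBeltrami (roundMetric n) (fun x : unitSphere n ↦ polyFun H x) x * polyFun Q x -
          polyFun H x * laplaceBeltrami (roundMetric n) (fun x : unitSphere n ↦ polyFun Q x) x =
          polyFun (polyLaplacian H) x * polyFun Q x -
            polyFun H x * polyFun (polyLaplacian Q) x := by
        rw [laplaceBeltrami_polyFun hH, laplaceBeltrami_polyFun hQ]
        ring
      simp only [e] at h3
      have hi (P Q : MvPolynomial (Fin (n + 1)) ℂ) :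
          Integrable (fun x : unitSphere n ↦ polyFun P x * polyFun Q x) (surfaceMeasure n) :=
        integrable_surfaceMeasure ((continuous_polyFun_coe P).mul (continuous_polyFun_coe Q))
      rw [integral_sub (hi _ _) (hi _ _), h1, ← h2, sub_zero] at h3
      exact h3
    exact (mul_eq_zero.1 h0).resolve_left (polyNormSq_ne_zero n.succ_pos)
  refine ⟨d, H, rfl, hH, hharm, fun x ↦ ?_⟩
  have hwH : IsWeakEigenfunction (sphereEigenvalue n d) fun x : unitSphere n ↦ polyFun H x :=
    isWeakEigenfunction_of_laplaceBeltrami (contMDiff_polyFun_coe H) fun x ↦ by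
      rw [laplaceBeltrami_polyFun hH, hharm]
      simp [polyFun]
  have hsub (P : MvPolynomial (Fin (n + 1)) ℂ) :
      ∫ x, (f x - polyFun H x) * polyFun P x ∂surfaceMeasure n =
        ∫ x, f x * polyFun P x ∂surfaceMeasure n -
        ∫ x : unitSphere n, polyFun H x * polyFun P x ∂surfaceMeasure n := by
    simp only [sub_mul]
    exact integral_sub (integrable_surfaceMeasure (hf.continuous.mul (continuous_polyFun_coe P)))
      (integrable_surfaceMeasure ((continuous_polyFun_coe H).mul (continuous_polyFun_coe P)))
  have hwg : IsWeakEigenfunction (sphereEigenvalue n d) fun x : unitSphere n ↦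
      f x - polyFun H x := fun k P hP ↦ by
    rw [hsub, hsub, mul_sub, hw k P hP, hwH k P hP]
  -- The difference f − H has the same eigenvalue and is orthogonal to degree d, the only degree
  -- where the recursion could stall.
  have hg0 := eq_zero_of_integral_mul_polyFun_eq_zero
    (hf.continuous.sub (continuous_polyFun_coe H)) fun k ↦
      hwg.integral_mul_polyFun_eq_zero k (fun j _ hj P hP ↦ by
        rw [← sphereEigenvalue_injective hn hj] at hP
        rw [hsub, hHf P hP, sub_self]) k le_rfl
  exact sub_eq_zero.1 (congrFun hg0 x)

end Orthogonality

end

/-! ### The gradient equation and the characterization -/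

section Characterization

open MeasureTheory

variable {n : ℕ}

/-- The restriction to the sphere of a harmonic homogeneous polynomial divisible by `‖x‖²`
vanishes. -/
theorem eq_zero_of_polyNormSq_dvd (hn : 0 < n) {d : ℕ} {H : MvPolynomial (Fin (n + 1)) ℂ}
    (hH : H.IsHomogeneous d) (hharm : polyLaplacian H = 0) (hdvd : polyNormSq (n + 1) ∣ H) :
    H = 0 := by
  by_contra hH0
  obtain ⟨Q, hQ⟩ := hdvd
  have hQ0 : Q ≠ 0 := by
    rintro rfl
    exact hH0 (by rw [hQ, mul_zero])
  have hr0 := polyNormSq_ne_zero n.succ_pos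
  have hdeg : d = 2 + Q.totalDegree := by
    rw [← hH.totalDegree hH0, hQ, MvPolynomial.totalDegree_mul_of_isDomain hr0 hQ0,
      isHomogeneous_polyNormSq.totalDegree hr0]
  have hHQ (x : unitSphere n) : polyFun H x = polyFun Q x := by
    rw [hQ, polyFun_mul, polyFun_polyNormSq, norm_coe_unitSphere]
    norm_num
  have hw : IsWeakEigenfunction (sphereEigenvalue n d) fun x : unitSphere n ↦ polyFun H x :=
    isWeakEigenfunction_of_laplaceBeltrami (contMDiff_polyFun_coe H) fun x ↦ by
      rw [laplaceBeltrami_polyFun hH, hharm]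
      simp [polyFun]
  have hconj : (polyConj Q).totalDegree ≤ Q.totalDegree := Finset.sup_mono (MvPolynomial.support_map_subset _ _)
  -- H is orthogonal to every degree below d. On the sphere it agrees with Q, of degree d − 2, so
  -- ∫|H|² is the integral of H times the conjugate of Q, which is 0.
  have hint : ∫ x : unitSphere n, polyFun H x * polyFun (polyConj Q) x ∂surfaceMeasure n = 0 := by
    rw [← (polyConj Q).sum_homogeneousComponent,
      integral_mul_polyFun_sum (continuous_polyFun_coe H)]
    refine Finset.sum_eq_zero fun k hk ↦ ?_
    have hk' : k < d := by
      rw [Finset.mem_range] at hk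
      omega
    refine hw.integral_mul_polyFun_eq_zero k (fun j hj hjd ↦ ?_) k le_rfl _
      (MvPolynomial.homogeneousComponent_isHomogeneous k _)
    have := sphereEigenvalue_injective hn hjd
    omega
  have hint' : ∫ x : unitSphere n, polyFun H x * starRingEnd ℂ (polyFun H x) ∂surfaceMeasure n =
      0 := by
    rw [← hint]
    simp only [polyFun_polyConj, hHQ]
  exact hH0 (eq_zero_of_polyFun_coe_eq_zero hH
    (congrFun (eq_zero_of_integral_mul_conj_eq_zero (continuous_polyFun_coe H) hint')))

/-- If c = 0, the homogeneous polynomial Δ(H²) vanishes on the sphere, hence identically. If c ≠ 0,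
H² is a multiple of |x|², which forces H = 0. -/
theorem polyLaplacian_sq_eq_zero (hn : 0 < n) {d : ℕ} {H : MvPolynomial (Fin (n + 1)) ℂ}
    (hH : H.IsHomogeneous d) (hharm : polyLaplacian H = 0) {c : ℂ}
    (hc : ∀ x : unitSphere n, polyFun (polyLaplacian (H ^ 2)) x = c * polyFun H x ^ 2) :
    polyLaplacian (H ^ 2) = 0 := by
  have hsq : (H ^ 2).IsHomogeneous (d * 2) := hH.pow 2
  have hpow (x : unitSphere n) : polyFun (H ^ 2) x = polyFun H x ^ 2 := map_pow _ _ _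
  by_cases hc0 : c = 0
  · exact eq_zero_of_polyFun_coe_eq_zero (isHomogeneous_polyLaplacian hsq) fun x ↦ by
      rw [hc, hc0, zero_mul]
  -- The factor |x|² brings both terms to degree 2d, so the identity on the sphere becomes one of
  -- polynomials.
  have hmul : c • H ^ 2 + -1 * (polyNormSq (n + 1) * polyLaplacian (H ^ 2)) = 0 := by
    have h1 : (c • H ^ 2).IsHomogeneous (d * 2) :=
      Submodule.smul_mem (MvPolynomial.homogeneousSubmodule _ ℂ _) c hsq
    have h2 : (-1 * (polyNormSq (n + 1) * polyLaplacian (H ^ 2))).IsHomogeneous (d * 2) := by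
      rw [neg_one_mul]
      exact (isHomogeneous_polyNormSq_mul_polyLaplacian hsq).neg
    refine eq_zero_of_polyFun_coe_eq_zero (h1.add h2) fun x ↦ ?_
    rw [polyFun_add, polyFun_smul, polyFun_mul, polyFun_mul, hc, hpow, polyFun_polyNormSq,
      norm_coe_unitSphere]
    simp [polyFun]
  have hdvd : polyNormSq (n + 1) ∣ H ^ 2 := by
    refine ⟨c⁻¹ • polyLaplacian (H ^ 2), ?_⟩
    rw [neg_one_mul, add_neg_eq_zero] at hmul
    rw [mul_smul_comm, ← hmul, smul_smul, inv_mul_cancel₀ hc0, one_smul]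
  rw [eq_zero_of_polyNormSq_dvd hn hH hharm (polyNormSq_dvd_of_dvd_sq hn hdvd)]
  simp

theorem polyFun_sq (P : MvPolynomial (Fin (n + 1)) ℂ) :
    (fun y ↦ polyFun P y ^ 2) = polyFun (P ^ 2) := funext fun _ ↦ (map_pow _ _ _).symm

theorem exists_polynomial_of_isComplexEigenfunction (hn : 0 < n) {f : unitSphere n → ℂ}
    (h : IsComplexEigenfunction (roundMetric n) f) :
    ∃ (d : ℕ) (P : MvPolynomial (Fin (n + 1)) ℂ), P.IsHomogeneous d ∧
      (∀ x : unitSphere n, f x = polyFun P x) ∧ polyLaplacian P = 0 ∧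
      polyLaplacian (P ^ 2) = 0 := by
  obtain ⟨hf, l, m, hl, hm⟩ := h
  -- The zero function satisfies the equations for every λ, so its λ determines no degree.
  by_cases hf0 : f = 0
  · exact ⟨0, 0, MvPolynomial.isHomogeneous_zero _ _ _, by simp [hf0, polyFun], by simp, by simp⟩
  obtain ⟨d, H, rfl, hH, hharm, hfH⟩ := exists_harmonic_polynomial hn hf hl hf0
  refine ⟨d, H, hH, hfH, hharm, polyLaplacian_sq_eq_zero hn hH hharm
    -- On the sphere, (2λ_d + 2μ)f² = Δ_S(f²) = Δ(H²) + λ_{2d} f².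
    (c := 2 * sphereEigenvalue n d + 2 * m - sphereEigenvalue n (d * 2)) fun x ↦ ?_⟩
  have h1 := laplaceBeltrami_sq hf x
  have h2 := laplaceBeltrami_polyFun (hH.pow 2) x
  have h3 : (fun y ↦ f y ^ 2) = fun x : unitSphere n ↦ polyFun (H ^ 2) x :=
    funext fun y ↦ by rw [hfH, ← polyFun_sq]
  rw [h3, h2, hl, hm, hfH, ← polyFun_sq H] at h1
  linear_combination h1

theorem isComplexEigenfunction_of_polynomial {d : ℕ} {P : MvPolynomial (Fin (n + 1)) ℂ}
    (hP : P.IsHomogeneous d) (h1 : polyLaplacian P = 0) (h2 : polyLaplacian (P ^ 2) = 0) :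
    IsComplexEigenfunction (roundMetric n) fun x : unitSphere n ↦ polyFun P x := by
  have hl (x : unitSphere n) : laplaceBeltrami (roundMetric n)
      (fun x : unitSphere n ↦ polyFun P x) x = sphereEigenvalue n d * polyFun P x := by
    rw [laplaceBeltrami_polyFun hP, h1]
    simp [polyFun]
  refine ⟨contMDiff_polyFun_coe P, sphereEigenvalue n d,
    -- This μ solves 2λ_d + 2μ = λ_{2d}; it equals −d².
    (sphereEigenvalue n (d * 2) - 2 * sphereEigenvalue n d) / 2, hl, fun x ↦ ?_⟩
  have h3 := laplaceBeltrami_sq (contMDiff_polyFun_coe (n := n) P) x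
  have h4 := laplaceBeltrami_polyFun (hP.pow 2) x
  have h5 : (fun y : unitSphere n ↦ polyFun P y ^ 2) = fun x : unitSphere n ↦ polyFun (P ^ 2) x :=
    funext fun y ↦ by rw [← polyFun_sq]
  have h6 : polyFun (polyLaplacian (P ^ 2)) (x : EuclideanSpace ℝ (Fin (n + 1))) = 0 := by
    simp [h2, polyFun]
  rw [h5, h4, h6, hl, ← polyFun_sq P] at h3
  linear_combination -h3 / 2

end Characterization

theorem theorem2 (n : ℕ) (hn : 2 ≤ n) (f : unitSphere n → ℂ) :
    IsComplexEigenfunction (roundMetric n) f ↔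
      ∃ (d : ℕ) (P : MvPolynomial (Fin (n + 1)) ℂ),
        P.IsHomogeneous d ∧
        (∀ x : unitSphere n, f x = polyFun P x) ∧
        (∀ x : EuclideanSpace ℝ (Fin (n + 1)), Δ (polyFun P) x = 0) ∧
        (∀ x : EuclideanSpace ℝ (Fin (n + 1)), Δ (fun y ↦ polyFun P y ^ 2) x = 0) := by
  constructor
  · intro h
    obtain ⟨d, P, hP, hfP, h1, h2⟩ := exists_polynomial_of_isComplexEigenfunction (by omega) h
    refine ⟨d, P, hP, hfP, fun x ↦ ?_, fun x ↦ ?_⟩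
    · rw [laplacian_polyFun, h1]
      simp [polyFun]
    · rw [polyFun_sq, laplacian_polyFun, h2]
      simp [polyFun]
  · rintro ⟨d, P, hP, hfP, h1, h2⟩
    rw [funext hfP]
    refine isComplexEigenfunction_of_polynomial hP ?_ ?_
    · exact eq_zero_of_polyFun_coe_eq_zero (isHomogeneous_polyLaplacian hP) fun x ↦ by
        rw [← laplacian_polyFun, h1]
    · exact eq_zero_of_polyFun_coe_eq_zero (isHomogeneous_polyLaplacian (hP.pow 2)) fun x ↦ by
        rw [← laplacian_polyFun, ← polyFun_sq, h2]
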